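/- All graphs are finite and simple. A graph is outerplanar if it has an embedding in the plane (vertices are distinct points, edges are Jordan arcs that meet only at common end-vertices) such that all vertices lie on the boundary of a single face. A tree covering of a graph $G$ is a family of pairwise vertex-disjoint induced subgraphs of $G$, each of which is a tree, that together contain all vertices of $G$. The tree cover number $T(G)$ is the minimum number of trees in a tree covering of $G$, and a tree covering with $T(G)$ trees is called minimum. Let $B$ be the set of black vertices of $G$, all other vertices being white. The positive colour change rule says that $u\in B$ can force (turn black) a white vertex $w$ if, for some connected component $W$ of $G\setminus B$, the vertex $w$ is the only neighbour of $u$ in $W$. A positive zero forcing process consists of an initial set $Z$ of black vertices and a chronological list of such forces, each applied to the set of black vertices at that moment, after which all vertices are black; then $Z$ is called a positive zero forcing set. The positive zero forcing number $Z_+(G)$ is the minimum size of a positive zero forcing set. For each $r\in Z$, the forcing tree of the process with root $r$ has as vertices $r$ and all vertices reached from $r$ by a sequence of forces of the process, and as edges the pairs $\{u,w\}$ of such vertices for which $u$ forces $w$ in the process. Theorem. Let $G$ be an outerplanar graph. Then $$Z_+(G)=T(G).$$ Moreover, every minimum tree covering $\mathcal T$ of $G$ is exactly the collection of forcing trees of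 some positive zero forcing process whose initial set has $Z_+(G)$ vertices; in particular $|\mathcal T|=Z_+(G)$. -/

import Mathlib

open unitInterval

namespace SimpleGraph

universe u

variable {V : Type u}

/-! ### Outerplanar graphs -/

/-- A planar embedding of a graph, the plane being `ℂ`: the vertices are distinct points, every edge
is drawn as a Jordan arc joining the points of its two ends, no arc passes through a vertex in its
interior, and the arcs of two different edges can only meet in (common) vertices. -/
structure PlanarEmbedding (G : SimpleGraph V) where
  point : V → ℂ
  point_injective : Function.Injective point
  arc : G.edgeSet → C(I, ℂ)
  arc_injective : ∀ e, Function.Injective (arc e)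
  arc_ends : ∀ e, s(arc e 0, arc e 1) = Sym2.map point e
  arc_avoids : ∀ (e : G.edgeSet) (t : I) (v : V), arc e t = point v → t = 0 ∨ t = 1
  arc_meet : ∀ e e' : G.edgeSet, e ≠ e' →
    ∀ s t : I, arc e s = arc e' t → ∃ v, arc e s = point v

/-- The subset of the plane covered by the drawing: all vertices and all edges. -/
def PlanarEmbedding.drawing {G : SimpleGraph V} (φ : G.PlanarEmbedding) : Set ℂ :=
  Set.range φ.point ∪ ⋃ e, Set.range (φ.arc e)

/-- The faces are the connected components of the complement of the drawing. -/
def PlanarEmbedding.IsFace {G : SimpleGraph V} (φ : G.PlanarEmbedding) (F : Set ℂ) : Prop :=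
  ∃ p ∈ φ.drawingᶜ, F = connectedComponentIn φ.drawingᶜ p

/-- A graph is outerplanar if it has a planar embedding with a face that has all the vertices on
its boundary. -/
def IsOuterplanar (G : SimpleGraph V) : Prop :=
  ∃ φ : G.PlanarEmbedding, ∃ F : Set ℂ, φ.IsFace F ∧ ∀ v, φ.point v ∈ frontier F

/-! ### Tree coverings -/

/-- A tree covering: a family of vertex-disjoint induced subgraphs, each of them a tree, that
together contain all the vertices. -/
structure IsTreeCovering (G : SimpleGraph V) (T : Set G.Subgraph) : Prop where
  isInduced : ∀ H ∈ T, H.IsInduced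
  isTree : ∀ H ∈ T, H.coe.IsTree
  disjoint : T.PairwiseDisjoint Subgraph.verts
  cover : ⋃ H ∈ T, H.verts = Set.univ

/-- The tree cover number `T(G)` (for a finite graph). -/
noncomputable def treeCoverNumber (G : SimpleGraph V) : ℕ :=
  sInf {k | ∃ T : Set G.Subgraph, G.IsTreeCovering T ∧ T.ncard = k}

/-! ### Positive zero forcing -/

/-- The positive colour change rule: if `B` is the set of black vertices, then `u` can force `w`
when `u` is black and, for some connected component `W` of `G \ B`, the vertex `w` is the only
neighbour of `u` in `W`. -/
def PositiveForces (G : SimpleGraph V) (B : Set V) (u w : V) : Prop :=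
  u ∈ B ∧ ∃ W : (G.induce Bᶜ).ConnectedComponent,
    {x | G.Adj u x ∧ ∃ hx : x ∈ Bᶜ, (G.induce Bᶜ).connectedComponentMk ⟨x, hx⟩ = W} = {w}

/-- `G.PositiveForcing B L C`: starting from the set `B` of black vertices, the forces in the
chronological list `L` (a pair `(u, w)` means that `u` forces `w`) can be performed one after the
other, and the set of black vertices is then `C`. -/
inductive PositiveForcing (G : SimpleGraph V) : Set V → List (V × V) → Set V → Prop
  | nil (B : Set V) : PositiveForcing G B [] B
  | cons {B C : Set V} {u w : V} {L : List (V × V)} (h : G.PositiveForces B u w)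
      (hL : PositiveForcing G (insert w B) L C) : PositiveForcing G B ((u, w) :: L) C

/-- A set of vertices is a positive zero forcing set if some sequence of forces starting from it
turns all the vertices black. -/
def IsPositiveZeroForcingSet (G : SimpleGraph V) (B : Set V) : Prop :=
  ∃ L, G.PositiveForcing B L Set.univ

/-- The positive zero forcing number `Z₊(G)` (for a finite graph). -/
noncomputable def positiveZeroForcingNumber (G : SimpleGraph V) : ℕ :=
  sInf {k | ∃ B : Set V, G.IsPositiveZeroForcingSet B ∧ B.ncard = k}

/-- The forcing tree with root `r` for a chronological list of forces `L`: its vertices are those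
that are reached from `r` by a sequence of forces in `L`, and its edges are the forces between
these vertices. (The clause `G.Adj a b` is automatic for the forces of a process.) -/
def forcingTree (G : SimpleGraph V) (L : List (V × V)) (r : V) : G.Subgraph where
  verts := {v | Relation.ReflTransGen (fun a b => (a, b) ∈ L) r v}
  Adj a b := Relation.ReflTransGen (fun a b => (a, b) ∈ L) r a ∧
    Relation.ReflTransGen (fun a b => (a, b) ∈ L) r b ∧ G.Adj a b ∧ ((a, b) ∈ L ∨ (b, a) ∈ L)
  adj_sub h := h.2.2.1
  edge_vert h := h.1
  symm := ⟨fun _ _ h => ⟨h.2.1, h.1, h.2.2.1.symm, h.2.2.2.symm⟩⟩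

end SimpleGraph

/-! Let `A` and `B` be disjoint compact sets with `a ∈ A` and `b ∈ B`. Then
`log ((z - a) / (z - b))` has no continuous branch on the complement of `A ∪ B`, whereas it has one
on the complement of any path joining `a` to `b`. An outerplanar drawing with a `K₄` minor gives
three such paths between the first two branch sets: one direct and one through each of the other
two. Every vertex touches the same face, so branches off the three paths that agree there agree
pairwise on the remaining path, and the branch whose imaginary part is the median of theirs is
continuous off the two branch sets, a contradiction. So outerplanar graphs have no `K₄` minor.

A graph without `K₄` minor that has an edge has a vertex of degree one or two. Given a tree
covering, delete the edges at this vertex if it is a tree of its own, and otherwise suppress it into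
an edge between its neighbours. The smaller graph has no `K₄` minor either, so by induction the
trees are the forcing trees of some process. Conversely the forcing trees of a process form a tree
covering. -/

open Filter Set SimpleGraph Topology

namespace PositiveZeroForcing

section Logarithm

open Complex

theorem eqOn_of_exp_eqOn {X : Type*} [TopologicalSpace X] {f g : X → ℂ} {s : Set X}
    (hs : IsPreconnected s) (hf : ContinuousOn f s) (hg : ContinuousOn g s)
    (h : ∀ x ∈ s, exp (f x) = exp (g x)) {p : X} (hp : p ∈ s) (hfg : f p = g p) : EqOn f g s :=
  isCoveringMap_exp.eqOn_of_comp_eqOn hs hf hg (fun x hx => Subtype.ext (h x hx)) hp hfg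

theorem exists_continuous_log {f : ℂ → ℂ} (hf : Continuous f) (hf₀ : ∀ z, f z ≠ 0) :
    ∃ ρ : ℂ → ℂ, Continuous ρ ∧ ∀ z, exp (ρ z) = f z := by
  obtain ⟨ρ, ⟨-, hρ⟩, -⟩ := isCoveringMap_exp.existsUnique_continuousMap_lifts
    ⟨fun z => (⟨f z, hf₀ z⟩ : {z : ℂ // z ≠ 0}), by fun_prop⟩ 0 (log (f 0))
    (Subtype.ext (exp_log (hf₀ 0)))
  exact ⟨ρ, ρ.continuous, fun z => congrArg Subtype.val (congrFun hρ z)⟩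

theorem not_exists_log_circle {a : ℂ} {r : ℝ} (hr : 0 < r) {ρ : ℂ → ℂ} (hρ : Continuous ρ)
    (h : ∀ z, ‖z - a‖ = r → exp (ρ z) = z - a) : False := by
  have hexp : ∀ t : ℝ, exp (ρ (circleMap a r t)) = r * exp (t * Complex.I) := fun t => by
    rw [h _ (by simp [abs_of_pos hr]), circleMap_sub_center, circleMap_zero]
  have hlift : EqOn (fun t : ℝ => ρ (circleMap a r t))
      (fun t => ρ (circleMap a r 0) + t * Complex.I) univ :=
    eqOn_of_exp_eqOn isPreconnected_univ (by fun_prop) (by fun_prop)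
      (fun t _ => by simp [exp_add, hexp]) (mem_univ 0) (by simp)
  have := hlift (mem_univ (2 * Real.pi))
  simp [circleMap, Real.pi_ne_zero] at this

theorem exists_cutoff {K L : Set ℂ} (hK : IsCompact K) (hL : IsClosed L) (hKL : Disjoint K L) :
    ∃ (χ : C(ℂ, ℝ)) (U W : Set ℂ), IsOpen U ∧ IsOpen W ∧ K ⊆ U ∧ L ⊆ W ∧ EqOn χ 1 U ∧ EqOn χ 0 W ∧
      Bornology.IsBounded Wᶜ := by
  obtain ⟨U, hU, hKU, hUL, hUc⟩ :=
    exists_open_between_and_isCompact_closure hK hL.isOpen_compl hKL.subset_compl_right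
  obtain ⟨V, hV, hUV, hVL, hVc⟩ := exists_open_between_and_isCompact_closure hUc hL.isOpen_compl hUL
  obtain ⟨χ, hχU, hχV, -, -⟩ := exists_continuous_one_zero_of_isCompact hUc hV.isClosed_compl
    (disjoint_compl_right_iff_subset.2 hUV)
  refine ⟨χ, U, (closure V)ᶜ, hU, isClosed_closure.isOpen_compl, hKU, subset_compl_comm.1 hVL,
    hχU.mono subset_closure, hχV.mono (compl_subset_compl.2 subset_closure), ?_⟩
  simpa using hVc.isBounded

/-- `IsLogBranch K a b f`: outside `K`, the function `f` is a continuous branch of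
`log ((z - a) / (z - b))`. Nothing is required of `f` on `K`. -/
structure IsLogBranch (K : Set ℂ) (a b : ℂ) (f : ℂ → ℂ) : Prop where
  continuousOn : ContinuousOn f Kᶜ
  exp_eq : ∀ z ∈ Kᶜ, exp (f z) = (z - a) / (z - b)

theorem exists_continuous_eqOn_sub {K L : Set ℂ} {a b : ℂ} {φ : ℂ → ℂ} (hK : IsCompact K)
    (hL : IsClosed L) (hKL : Disjoint K L) (ha : a ∈ K) (hb : b ∈ L)
    (hφ : IsLogBranch (K ∪ L) a b φ) :
    ∃ R : ℂ → ℂ, Continuous R ∧ (∀ z, R z ≠ 0) ∧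
      ∃ W, Bornology.IsBounded Wᶜ ∧ EqOn R (fun z => z - a) W := by
  classical
  obtain ⟨χ, U, W, hU, hW, hKU, hLW, hχU, hχW, hbdd⟩ := exists_cutoff hK hL hKL
  have hUW : ∀ z ∈ U, z ∉ W := fun z hzU hzW => by
    simpa using (hχU hzU).symm.trans (hχW hzW)
  let R : ℂ → ℂ := fun z => if z ∈ K then z - b else (z - a) * exp (-(χ z * φ z))
  have hR : EqOn R (fun z => (z - a) * exp (-(χ z * φ z))) Kᶜ := fun z hz => if_neg hz
  have hRU : EqOn R (fun z => z - b) U := fun z hz => by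
    by_cases hzK : z ∈ K
    · exact if_pos hzK
    · have hza : z - a ≠ 0 := sub_ne_zero.2 fun h0 => hzK (h0 ▸ ha)
      have hz' := hφ.exp_eq z fun h' => h'.elim hzK fun hzL => hUW z hz (hLW hzL)
      simp only [hR hzK, hχU hz, exp_neg, Pi.one_apply, ofReal_one, one_mul, hz']
      field_simp
  have hRW : EqOn R (fun z => z - a) W := fun z hz => by
    simp [hR fun hzK => hUW z (hKU hzK) hz, hχW hz]
  refine ⟨R, continuous_iff_continuousAt.2 fun z => ?_, fun z => ?_, W, hbdd, hRW⟩
  · by_cases hzK : z ∈ K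
    · exact (continuous_id.sub continuous_const).continuousAt.congr
        (hRU.symm.eventuallyEq_of_mem (hU.mem_nhds (hKU hzK)))
    by_cases hzL : z ∈ L
    · exact (continuous_id.sub continuous_const).continuousAt.congr
        (hRW.symm.eventuallyEq_of_mem (hW.mem_nhds (hLW hzL)))
    have hφz : ContinuousAt φ z := hφ.continuousOn.continuousAt
      ((hK.isClosed.union hL).isOpen_compl.mem_nhds fun h' => h'.elim hzK hzL)
    exact ContinuousAt.congr (f := fun z => (z - a) * exp (-(χ z * φ z))) (by fun_prop)
      (hR.symm.eventuallyEq_of_mem (hK.isClosed.isOpen_compl.mem_nhds hzK))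
  · by_cases hzK : z ∈ K
    · rw [hRU (hKU hzK)]
      exact sub_ne_zero.2 fun h0 => hUW z (hKU hzK) (hLW (h0 ▸ hb))
    · rw [hR hzK]
      exact mul_ne_zero (sub_ne_zero.2 fun h0 => hzK (h0 ▸ ha)) (exp_ne_zero _)

theorem not_isLogBranch_union {K L : Set ℂ} {a b : ℂ} {φ : ℂ → ℂ} (hK : IsCompact K)
    (hL : IsClosed L) (hKL : Disjoint K L) (ha : a ∈ K) (hb : b ∈ L) :
    ¬ IsLogBranch (K ∪ L) a b φ := fun hφ => by
  obtain ⟨R, hR, hR₀, W, hW, hRW⟩ := exists_continuous_eqOn_sub hK hL hKL ha hb hφ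
  obtain ⟨ρ, hρ, hρR⟩ := exists_continuous_log hR hR₀
  obtain ⟨r, hr, hWr⟩ := hW.subset_ball_lt 0 a
  refine not_exists_log_circle hr hρ fun z hz => (hρR z).trans (hRW ?_)
  by_contra hzW
  exact (mem_ball_iff_norm.1 (hWr hzW)).ne hz

namespace IsLogBranch

variable {K L : Set ℂ} {a b c : ℂ} {f g : ℂ → ℂ}

theorem mono (hf : IsLogBranch K a b f) (hKL : K ⊆ L) : IsLogBranch L a b f :=
  ⟨hf.continuousOn.mono (compl_subset_compl.2 hKL),
    fun z hz => hf.exp_eq z (compl_subset_compl.2 hKL hz)⟩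

theorem add (hf : IsLogBranch K a b f) (hg : IsLogBranch K b c g) (hb : b ∈ K) :
    IsLogBranch K a c fun z => f z + g z where
  continuousOn := hf.continuousOn.add hg.continuousOn
  exp_eq z hz := by
    rw [exp_add, hf.exp_eq z hz, hg.exp_eq z hz,
      div_mul_div_cancel₀ (sub_ne_zero.2 fun h0 => hz (by rwa [h0]))]

theorem log_norm_add_im (hf : IsLogBranch K a b f) {z : ℂ} (hz : z ∉ K) :
    (Real.log ‖(z - a) / (z - b)‖ : ℂ) + (f z).im * Complex.I = f z := by
  rw [← hf.exp_eq z hz, norm_exp, Real.log_exp, re_add_im]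

theorem eqOn (hf : IsLogBranch K a b f) (hg : IsLogBranch L a b g) {S : Set ℂ}
    (hS : IsPreconnected S) (hSK : S ⊆ Kᶜ) (hSL : S ⊆ Lᶜ) {p : ℂ} (hp : p ∈ S)
    (hfg : f p = g p) : EqOn f g S :=
  eqOn_of_exp_eqOn hS (hf.continuousOn.mono hSK) (hg.continuousOn.mono hSL)
    (fun z hz => (hf.exp_eq z (hSK hz)).trans (hg.exp_eq z (hSL hz)).symm) hp hfg

theorem eventually_eq (hf : IsLogBranch K a b f) (hg : IsLogBranch L a b g) (hK : IsClosed K)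
    (hL : IsClosed L) {z : ℂ} (hzK : z ∉ K) (hzL : z ∉ L) (hfg : f z = g z) :
    ∀ᶠ w in 𝓝 z, w ∉ K ∧ f w = g w := by
  obtain ⟨ε, hε, hball⟩ :=
    Metric.isOpen_iff.1 (hK.isOpen_compl.inter hL.isOpen_compl) z ⟨hzK, hzL⟩
  filter_upwards [Metric.ball_mem_nhds z hε] with w hw
  exact ⟨(hball hw).1, hf.eqOn hg (convex_ball z ε).isPreconnected (fun x hx => (hball hx).1)
    (fun x hx => (hball hx).2) (Metric.mem_ball_self hε) hfg hw⟩

end IsLogBranch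

/-- The median of three real numbers. -/
noncomputable def median (x y z : ℝ) : ℝ := max (min x y) (min (max x y) z)

theorem median_mem (x y z : ℝ) : median x y z = x ∨ median x y z = y ∨ median x y z = z := by
  unfold median; grind

theorem median_left (x y : ℝ) : median x y y = y := by unfold median; grind

theorem median_middle (x y : ℝ) : median y x y = y := by unfold median; grind

theorem median_right (x y : ℝ) : median y y x = y := by unfold median; grind

/-- The candidate for a branch of `log ((z - a) / (z - b))` that is obtained from three branches
`f`, `g`, `h` by taking the median of their imaginary parts. It follows the two functions that agree
where the third one is not a branch. -/
noncomputable def medianLog (a b : ℂ) (f g h : ℂ → ℂ) (z : ℂ) : ℂ :=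
  Real.log ‖(z - a) / (z - b)‖ + median (f z).im (g z).im (h z).im * Complex.I

section medianLog

variable {A B C N : Set ℂ} {a b z : ℂ} {f g h : ℂ → ℂ}

theorem medianLog_eq_of_right (hg : IsLogBranch B a b g) (hz : z ∉ B) (hgh : g z = h z) :
    medianLog a b f g h z = g z := by
  rw [medianLog, ← hgh, median_left, hg.log_norm_add_im hz]

theorem medianLog_eq_of_outer (hf : IsLogBranch A a b f) (hz : z ∉ A) (hfh : f z = h z) :
    medianLog a b f g h z = f z := by
  rw [medianLog, ← hfh, median_middle, hf.log_norm_add_im hz]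

theorem medianLog_eq_of_left (hf : IsLogBranch A a b f) (hz : z ∉ A) (hfg : f z = g z) :
    medianLog a b f g h z = f z := by
  rw [medianLog, ← hfg, median_right, hf.log_norm_add_im hz]

theorem isLogBranch_medianLog (hf : IsLogBranch A a b f) (hg : IsLogBranch B a b g)
    (hh : IsLogBranch C a b h) (ha : a ∈ A) (hb : b ∈ A) :
    IsLogBranch (A ∪ B ∪ C) a b (medianLog a b f g h) where
  continuousOn := by
    have hf' := hf.continuousOn.mono (t := (A ∪ B ∪ C)ᶜ) fun z hz hzA => hz (.inl (.inl hzA))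
    have hg' := hg.continuousOn.mono (t := (A ∪ B ∪ C)ᶜ) fun z hz hzB => hz (.inl (.inr hzB))
    have hh' := hh.continuousOn.mono (t := (A ∪ B ∪ C)ᶜ) fun z hz hzC => hz (.inr hzC)
    have hne : ∀ z ∈ (A ∪ B ∪ C)ᶜ, z - a ≠ 0 ∧ z - b ≠ 0 := fun z hz =>
      ⟨sub_ne_zero.2 fun h0 => hz (.inl (.inl (by rwa [h0]))),
        sub_ne_zero.2 fun h0 => hz (.inl (.inl (by rwa [h0])))⟩
    have hq : ContinuousOn (fun z => Real.log ‖(z - a) / (z - b)‖) (A ∪ B ∪ C)ᶜ :=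
      ((by fun_prop : ContinuousOn (fun z => z - a) _).div (by fun_prop)
        fun z hz => (hne z hz).2).norm.log fun z hz =>
          norm_ne_zero_iff.2 (div_ne_zero (hne z hz).1 (hne z hz).2)
    unfold medianLog median
    fun_prop
  exp_eq z hz := by
    simp only [mem_compl_iff, mem_union, not_or] at hz
    obtain ⟨⟨hA, hB⟩, hC⟩ := hz
    unfold medianLog
    rcases median_mem (f z).im (g z).im (h z).im with hm | hm | hm <;> rw [hm]
    · rw [hf.log_norm_add_im hA, hf.exp_eq z hA]
    · rw [hg.log_norm_add_im hB, hg.exp_eq z hB]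
    · rw [hh.log_norm_add_im hC, hh.exp_eq z hC]

theorem isLogBranch_of_eventually_eq {φ : ℂ → ℂ}
    (h : ∀ z ∈ Nᶜ, ∃ K f, IsClosed K ∧ z ∉ K ∧ IsLogBranch K a b f ∧ ∀ᶠ w in 𝓝 z, φ w = f w) :
    IsLogBranch N a b φ where
  continuousOn z hz := by
    obtain ⟨K, f, hK, hzK, hf, hφ⟩ := h z hz
    exact ((hf.continuousOn.continuousAt (hK.isOpen_compl.mem_nhds hzK)).congr
      (EventuallyEq.symm hφ)).continuousWithinAt
  exp_eq z hz := by
    obtain ⟨K, f, -, hzK, hf, hφ⟩ := h z hz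
    rw [hφ.self_of_nhds, hf.exp_eq z hzK]

theorem isLogBranch_medianLog_of_theta (hA : IsClosed A) (hB : IsClosed B) (hC : IsClosed C)
    (hf : IsLogBranch A a b f) (hg : IsLogBranch B a b g) (hh : IsLogBranch C a b h)
    (ha : a ∈ A) (hb : b ∈ A) (hAB : A ∩ B ⊆ N) (hAC : A ∩ C ⊆ N) (hBC : B ∩ C ⊆ N)
    (hgh : EqOn g h (A \ N)) (hfh : EqOn f h (B \ N)) (hfg : EqOn f g (C \ N)) :
    IsLogBranch N a b (medianLog a b f g h) := by
  refine isLogBranch_of_eventually_eq fun z hz => ?_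
  by_cases hzA : z ∈ A
  · have hzB : z ∉ B := fun h' => hz (hAB ⟨hzA, h'⟩)
    have hzC : z ∉ C := fun h' => hz (hAC ⟨hzA, h'⟩)
    exact ⟨B, g, hB, hzB, hg, (hg.eventually_eq hh hB hC hzB hzC (hgh ⟨hzA, hz⟩)).mono
      fun w hw => medianLog_eq_of_right hg hw.1 hw.2⟩
  by_cases hzB : z ∈ B
  · have hzC : z ∉ C := fun h' => hz (hBC ⟨hzB, h'⟩)
    exact ⟨A, f, hA, hzA, hf, (hf.eventually_eq hh hA hC hzA hzC (hfh ⟨hzB, hz⟩)).mono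
      fun w hw => medianLog_eq_of_outer hf hw.1 hw.2⟩
  by_cases hzC : z ∈ C
  · exact ⟨A, f, hA, hzA, hf, (hf.eventually_eq hg hA hB hzA hzB (hfg ⟨hzC, hz⟩)).mono
      fun w hw => medianLog_eq_of_left hf hw.1 hw.2⟩
  · exact ⟨A ∪ B ∪ C, _, (hA.union hB).union hC, by simp [hzA, hzB, hzC],
      isLogBranch_medianLog hf hg hh ha hb, .of_forall fun _ => rfl⟩

end medianLog

theorem exists_isLogBranch {K : Set ℂ} {a b : ℂ} (h : JoinedIn K a b) :
    ∃ f, IsLogBranch K a b f := by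
  obtain ⟨γ, hγ⟩ := h.symm
  have hne : ∀ (t : unitInterval) (z : ↥Kᶜ), (z : ℂ) - γ t ≠ 0 := fun t z =>
    sub_ne_zero.2 fun h0 => z.2 (by rw [h0]; exact hγ t)
  have hb : ∀ z : ↥Kᶜ, (z : ℂ) - b ≠ 0 := fun z => by simpa using hne 0 z
  -- Deform the numerator: `(z - γ t) / (z - b)` is `1` at `t = 0`, and there `0` is a logarithm.
  have hcont : Continuous fun x : unitInterval × ↥Kᶜ => ((x.2 : ℂ) - γ x.1) / (x.2 - b) :=
    Continuous.div (by fun_prop) (by fun_prop) fun x => hb x.2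
  let H : C(unitInterval × ↥Kᶜ, {z : ℂ // z ≠ 0}) :=
    ⟨fun x => ⟨_, div_ne_zero (hne x.1 x.2) (hb x.2)⟩, hcont.subtype_mk _⟩
  have hH : ∀ t z, (H (t, z) : ℂ) = (z - γ t) / (z - b) := fun _ _ => rfl
  have H0 : ∀ z, H (0, z) = ⟨exp ((0 : C(↥Kᶜ, ℂ)) z), exp_ne_zero _⟩ := fun z =>
    Subtype.ext (by simp [hH, div_self (hb z)])
  obtain ⟨F, hF⟩ : ∃ F : C(↥Kᶜ, ℂ), ∀ z, exp (F z) = ((z : ℂ) - a) / (z - b) :=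
    ⟨(isCoveringMap_exp.liftHomotopy H 0 H0).comp (.prodMk (.const _ 1) (.id _)), fun z => by
      have := congrFun (isCoveringMap_exp.liftHomotopy_lifts H 0 H0) (1, z)
      simpa [hH] using congrArg Subtype.val this⟩
  have hext : ∀ z : ↥Kᶜ, Function.extend Subtype.val F 0 z = F z :=
    Subtype.val_injective.extend_apply _ _
  refine ⟨_, ?_, fun z hz => (congrArg exp (hext ⟨z, hz⟩)).trans (hF ⟨z, hz⟩)⟩
  rw [continuousOn_iff_continuous_domRestrict]
  exact F.continuous.congr fun z => (hext z).symm

theorem exists_isLogBranch_apply_eq {K : Set ℂ} {a b p l : ℂ} (h : JoinedIn K a b) (hp : p ∉ K)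
    (hl : exp l = (p - a) / (p - b)) : ∃ f, IsLogBranch K a b f ∧ f p = l := by
  obtain ⟨f, hf⟩ := exists_isLogBranch h
  refine ⟨fun z => f z + (l - f p), ⟨hf.continuousOn.add continuousOn_const, fun z hz => ?_⟩,
    by ring⟩
  rw [exp_add, exp_sub, hl, hf.exp_eq p hp, div_self (by rw [← hl]; exact exp_ne_zero l), mul_one,
    hf.exp_eq z hz]

end Logarithm

variable {V W : Type*} {G : SimpleGraph V}

section Minor

/-- A model of the graph `H` as a minor of `G`: pairwise disjoint connected branch sets `S i`, one
for each vertex of `H`, such that adjacent vertices of `H` have branch sets that are joined by an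
edge of `G`. -/
structure IsMinorModel (H : SimpleGraph W) (G : SimpleGraph V) (S : W → Set V) : Prop where
  connected : ∀ i, (G.induce (S i)).Connected
  disjoint : Pairwise fun i j => Disjoint (S i) (S j)
  exists_adj : ∀ ⦃i j⦄, H.Adj i j → ∃ x ∈ S i, ∃ y ∈ S j, G.Adj x y

/-- `H` is a minor of `G` if it has a model in `G`. -/
def IsMinor (H : SimpleGraph W) (G : SimpleGraph V) : Prop :=
  ∃ S, IsMinorModel H G S

namespace IsMinorModel

variable {H : SimpleGraph W} {S : W → Set V}

theorem connected_union (h : IsMinorModel H G S) {i j : W} (hij : H.Adj i j) :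
    (G.induce (S i ∪ S j)).Connected := by
  obtain ⟨x, hx, y, hy, hxy⟩ := h.exists_adj hij
  exact connected_induce_union (h.connected i).preconnected (h.connected j).preconnected hx hy hxy

end IsMinorModel

end Minor

section Drawing

variable {φ : G.PlanarEmbedding} {S T U : Set V} {u v : V}

/-- The part of the drawing that shows the subgraph induced on `S`: the points of the vertices in
`S` and the arcs of the edges with both ends in `S`. -/
def drawingOn (φ : G.PlanarEmbedding) (S : Set V) : Set ℂ :=
  φ.point '' S ∪ ⋃ e : {e : G.edgeSet // ∀ v ∈ e.1, v ∈ S}, range (φ.arc e.1)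

theorem point_mem_range_arc {e : G.edgeSet} : φ.point v ∈ range (φ.arc e) ↔ v ∈ e.1 := by
  have hends : φ.point v ∈ s(φ.arc e 0, φ.arc e 1) ↔ v ∈ e.1 := by
    simp [φ.arc_ends, Sym2.mem_map, φ.point_injective.eq_iff]
  rw [← hends, Sym2.mem_iff]
  constructor
  · rintro ⟨t, ht⟩
    rcases φ.arc_avoids e t v ht with rfl | rfl
    exacts [.inl ht.symm, .inr ht.symm]
  · rintro (h | h)
    exacts [⟨0, h.symm⟩, ⟨1, h.symm⟩]

theorem point_mem_drawingOn : φ.point v ∈ drawingOn φ S ↔ v ∈ S := by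
  refine ⟨?_, fun hv => .inl ⟨v, hv, rfl⟩⟩
  rintro (⟨w, hw, hwv⟩ | h)
  · exact φ.point_injective hwv ▸ hw
  · obtain ⟨e, he⟩ := mem_iUnion.1 h
    exact e.2 v (point_mem_range_arc.1 he)

theorem range_arc_subset_drawingOn {e : G.edgeSet} (he : ∀ v ∈ e.1, v ∈ S) :
    range (φ.arc e) ⊆ drawingOn φ S :=
  fun _ hz => .inr (mem_iUnion.2 ⟨⟨e, he⟩, hz⟩)

theorem drawingOn_mono (h : S ⊆ T) : drawingOn φ S ⊆ drawingOn φ T := by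
  rintro z (⟨v, hv, rfl⟩ | hz)
  · exact point_mem_drawingOn.2 (h hv)
  · obtain ⟨e, he⟩ := mem_iUnion.1 hz
    exact range_arc_subset_drawingOn (fun v hv => h (e.2 v hv)) he

theorem drawingOn_subset_drawing : drawingOn φ S ⊆ φ.drawing :=
  union_subset_union (image_subset_range _ _)
    (iUnion_subset fun e => subset_iUnion_of_subset e.1 .rfl)

theorem isCompact_drawingOn [Finite V] : IsCompact (drawingOn φ S) :=
  (S.toFinite.image _).isCompact.union
    (isCompact_iUnion fun e => isCompact_range (φ.arc e.1).continuous)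

theorem mem_drawingOn_inter_of_mem_arc {e : G.edgeSet} (he : ∀ v ∈ e.1, v ∈ S) {z : ℂ}
    (hz : z ∈ range (φ.arc e)) (hzT : z ∈ drawingOn φ T) : z ∈ drawingOn φ (S ∩ T) := by
  rcases hzT with ⟨v, hv, rfl⟩ | hzT
  · exact point_mem_drawingOn.2 ⟨he v (point_mem_range_arc.1 hz), hv⟩
  obtain ⟨⟨e', he'⟩, t', ht'⟩ := mem_iUnion.1 hzT
  obtain ⟨t, rfl⟩ := hz
  obtain rfl | hee := eq_or_ne e e'
  · exact range_arc_subset_drawingOn (S := S ∩ T) (fun v hv => ⟨he v hv, he' v hv⟩)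
      (mem_range_self t)
  · obtain ⟨v, hv⟩ := φ.arc_meet e e' hee t t' ht'.symm
    rw [hv, point_mem_drawingOn]
    exact ⟨he v (point_mem_range_arc.1 ⟨t, hv⟩), he' v (point_mem_range_arc.1 ⟨t', ht'.trans hv⟩)⟩

theorem drawingOn_inter_subset (h : S ∩ T ⊆ U) :
    drawingOn φ S ∩ drawingOn φ T ⊆ drawingOn φ U := by
  rintro z ⟨⟨v, hv, rfl⟩ | hzS, hzT⟩
  · exact point_mem_drawingOn.2 (h ⟨hv, point_mem_drawingOn.1 hzT⟩)
  · obtain ⟨e, he⟩ := mem_iUnion.1 hzS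
    exact drawingOn_mono h (mem_drawingOn_inter_of_mem_arc e.2 he hzT)

theorem drawingOn_empty : drawingOn φ ∅ = ∅ := by
  simp only [drawingOn, image_empty, empty_union, iUnion_eq_empty]
  exact fun e => (e.2 _ (Sym2.out_fst_mem e.1.1)).elim

theorem disjoint_drawingOn (h : Disjoint S T) : Disjoint (drawingOn φ S) (drawingOn φ T) := by
  rw [disjoint_iff_inter_eq_empty, ← subset_empty_iff, ← drawingOn_empty (φ := φ)]
  exact drawingOn_inter_subset h.inter_eq.subset

theorem joinedIn_drawingOn_of_adj (h : G.Adj u v) (hu : u ∈ S) (hv : v ∈ S) :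
    JoinedIn (drawingOn φ S) (φ.point u) (φ.point v) := by
  let e : G.edgeSet := ⟨s(u, v), h⟩
  have he : range (φ.arc e) ⊆ drawingOn φ S := range_arc_subset_drawingOn (by simp [e, hu, hv])
  have hjoined : JoinedIn (drawingOn φ S) (φ.arc e 0) (φ.arc e 1) :=
    ⟨⟨φ.arc e, rfl, rfl⟩, fun t => he ⟨t, rfl⟩⟩
  rcases Sym2.eq_iff.1 (φ.arc_ends e : s(φ.arc e 0, φ.arc e 1) = s(φ.point u, φ.point v)) with
    ⟨h0, h1⟩ | ⟨h0, h1⟩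
  · rwa [h0, h1] at hjoined
  · rw [h0, h1] at hjoined
    exact hjoined.symm

theorem joinedIn_drawingOn (hS : (G.induce S).Connected) (hu : u ∈ S) (hv : v ∈ S) :
    JoinedIn (drawingOn φ S) (φ.point u) (φ.point v) := by
  obtain ⟨p⟩ := hS.preconnected ⟨u, hu⟩ ⟨v, hv⟩
  suffices ∀ {x y : S} (_ : (G.induce S).Walk x y),
      JoinedIn (drawingOn φ S) (φ.point x) (φ.point y) from this p
  intro x y p
  induction p with
  | nil => exact .refl (point_mem_drawingOn.2 (Subtype.prop _))
  | @cons x y _ h _ ih => exact (joinedIn_drawingOn_of_adj (G.induce_adj.1 h) x.2 y.2).trans ih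

theorem exists_isPreconnected_subset_arc {e : G.edgeSet} (hve : v ∈ e.1) (hv : v ∉ S) {z : ℂ}
    (hz : z ∈ range (φ.arc e)) (hzS : z ∉ drawingOn φ S) :
    ∃ C, IsPreconnected C ∧ φ.point v ∈ C ∧ z ∈ C ∧ C ⊆ (drawingOn φ S)ᶜ := by
  obtain ⟨s, hs⟩ := point_mem_range_arc.2 hve
  obtain ⟨t, rfl⟩ := hz
  refine ⟨φ.arc e '' uIcc s t, ordConnected_uIcc.isPreconnected.image _
    (φ.arc e).continuous.continuousOn, ⟨s, left_mem_uIcc, hs⟩, ⟨t, right_mem_uIcc, rfl⟩, ?_⟩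
  rintro _ ⟨r, hr, rfl⟩ hrS
  -- A point of the arc that lies in `drawingOn φ S` is an end of `e`, and neither of these is
  -- strictly between the end at `v` and `z`.
  obtain ⟨w, hw⟩ : ∃ w, φ.arc e r = φ.point w := by
    rcases hrS with ⟨w, -, hw⟩ | hrS
    · exact ⟨w, hw.symm⟩
    · obtain ⟨⟨e', he'⟩, r', hr'⟩ := mem_iUnion.1 hrS
      exact φ.arc_meet e e' (fun hee => hv (he' v (hee ▸ hve))) r r' hr'.symm
  have hrs : r ≠ s := fun h => hv (point_mem_drawingOn.1 (by rwa [← hs, ← h]))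
  have hrt : r ≠ t := fun h => hzS (h ▸ hrS)
  rcases φ.arc_avoids e r w hw with rfl | rfl <;> rcases φ.arc_avoids e s v hs with rfl | rfl
  · exact hrs rfl
  · rw [uIcc_of_ge unitInterval.le_one'] at hr
    exact hrt (le_antisymm unitInterval.nonneg' hr.1)
  · rw [uIcc_of_le unitInterval.nonneg'] at hr
    exact hrt (le_antisymm hr.2 unitInterval.le_one')
  · exact hrs rfl

variable {F : Set ℂ}

theorem exists_isPreconnected_union (hF : IsPreconnected F) (hFφ : F ⊆ φ.drawingᶜ)
    (hcl : ∀ v, φ.point v ∈ closure F) {z : ℂ} (hz : z ∈ φ.drawing) (hzS : z ∉ drawingOn φ S) :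
    ∃ C, IsPreconnected C ∧ F ⊆ C ∧ z ∈ C ∧ C ⊆ (drawingOn φ S)ᶜ := by
  have hFS : F ⊆ (drawingOn φ S)ᶜ :=
    hFφ.trans (compl_subset_compl.2 drawingOn_subset_drawing)
  have hins : ∀ v, IsPreconnected (insert (φ.point v) F) := fun v =>
    hF.subset_closure (subset_insert _ _) (insert_subset (hcl v) subset_closure)
  rcases hz with ⟨v, rfl⟩ | hz
  · exact ⟨_, hins v, subset_insert _ _, mem_insert _ _, insert_subset hzS hFS⟩
  obtain ⟨e, he⟩ := mem_iUnion.1 hz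
  obtain ⟨v, hve, hv⟩ : ∃ v ∈ e.1, v ∉ S := by
    by_contra! h
    exact hzS (range_arc_subset_drawingOn h he)
  obtain ⟨C, hC, hvC, hzC, hCS⟩ := exists_isPreconnected_subset_arc hve hv he hzS
  exact ⟨insert (φ.point v) F ∪ C, (hins v).union _ (mem_insert _ _) hvC hC,
    (subset_insert _ _).trans subset_union_left, .inr hzC,
    union_subset (insert_subset (hCS hvC) hFS) hCS⟩

theorem eqOn_drawing_diff (hF : IsPreconnected F) (hFφ : F ⊆ φ.drawingᶜ)
    (hcl : ∀ v, φ.point v ∈ closure F) {a b p : ℂ} {f g : ℂ → ℂ}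
    (hf : IsLogBranch (drawingOn φ S) a b f) (hg : IsLogBranch (drawingOn φ S) a b g)
    (hp : p ∈ F) (hfg : f p = g p) : EqOn f g (φ.drawing \ drawingOn φ S) := fun z hz => by
  obtain ⟨C, hC, hFC, hzC, hCS⟩ := exists_isPreconnected_union hF hFφ hcl hz.1 hz.2
  exact hf.eqOn hg hC hCS hCS (hFC hp) hfg hzC

theorem exists_isLogBranch_family {ι : Type*} {S : ι → Set V}
    (hS : ∀ i j, (G.induce (S i ∪ S j)).Connected) {s : ι → V} (hs : ∀ i, s i ∈ S i) {p : ℂ}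
    (hp : p ∉ φ.drawing) :
    ∃ (l : ι → ℂ) (f : ι → ι → ℂ → ℂ), ∀ i j,
      IsLogBranch (drawingOn φ (S i ∪ S j)) (φ.point (s i)) (φ.point (s j)) (f i j) ∧
        f i j p = l i - l j := by
  have hps : ∀ i, p - φ.point (s i) ≠ 0 := fun i =>
    sub_ne_zero.2 fun h => hp (.inl ⟨s i, h.symm⟩)
  refine ⟨fun i => Complex.log (p - φ.point (s i)), ?_⟩
  choose f hf using fun i j => exists_isLogBranch_apply_eq
    (joinedIn_drawingOn (φ := φ) (hS i j) (.inl (hs i)) (.inr (hs j)))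
    (fun h => hp (drawingOn_subset_drawing h))
    (show Complex.exp (Complex.log (p - φ.point (s i)) - Complex.log (p - φ.point (s j))) = _ by
      rw [Complex.exp_sub, Complex.exp_log (hps i), Complex.exp_log (hps j)])
  exact ⟨f, hf⟩

theorem exists_isLogBranch_cocycle {ι : Type*} {S : ι → Set V} (hF : φ.IsFace F)
    (hcl : ∀ v, φ.point v ∈ closure F) (hS : ∀ i j, (G.induce (S i ∪ S j)).Connected)
    {s : ι → V} (hs : ∀ i, s i ∈ S i) :
    ∃ f : ι → ι → ℂ → ℂ,
      (∀ i j, IsLogBranch (drawingOn φ (S i ∪ S j)) (φ.point (s i)) (φ.point (s j)) (f i j)) ∧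
      ∀ i j k, EqOn (fun z => f i j z + f j k z) (f i k)
        (φ.drawing \ drawingOn φ (S i ∪ S j ∪ S k)) := by
  obtain ⟨p, hp, rfl⟩ := hF
  obtain ⟨l, f, hf⟩ := exists_isLogBranch_family hS hs hp
  refine ⟨f, fun i j => (hf i j).1, fun i j k => ?_⟩
  exact eqOn_drawing_diff isPreconnected_connectedComponentIn (connectedComponentIn_subset _ _) hcl
    (((hf i j).1.mono (drawingOn_mono (by grind))).add
      ((hf j k).1.mono (drawingOn_mono (by grind))) (point_mem_drawingOn.2 (by grind)))
    ((hf i k).1.mono (drawingOn_mono (by grind))) (mem_connectedComponentIn hp) (by grind)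

/-- The three logarithms `f 0 2 + f 2 1`, `f 0 3 + f 3 1` and `f 0 1` form a theta whose two
vertices are the drawings of `S 0` and `S 1`. -/
theorem isLogBranch_of_cocycle [Finite V] {S : Fin 4 → Set V}
    (hS : Pairwise fun i j => Disjoint (S i) (S j)) {s : Fin 4 → V}
    (hs : ∀ i, s i ∈ S i) {f : Fin 4 → Fin 4 → ℂ → ℂ}
    (hf : ∀ i j, IsLogBranch (drawingOn φ (S i ∪ S j)) (φ.point (s i)) (φ.point (s j)) (f i j))
    (cocycle : ∀ i j k, EqOn (fun z => f i j z + f j k z) (f i k)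
      (φ.drawing \ drawingOn φ (S i ∪ S j ∪ S k))) :
    IsLogBranch (drawingOn φ (S 0) ∪ drawingOn φ (S 1)) (φ.point (s 0)) (φ.point (s 1))
      (medianLog (φ.point (s 0)) (φ.point (s 1)) (fun z => f 0 2 z + f 2 1 z)
        (fun z => f 0 3 z + f 3 1 z) (f 0 1)) := by
  have hdisj : ∀ {i j v}, v ∈ S i → v ∈ S j → i = j := fun {i j v} hi hj => by
    by_contra hij
    exact (hS hij).notMem_of_mem_left hi hj
  have hclosed : ∀ T, IsClosed (drawingOn φ T) := fun T => isCompact_drawingOn.isClosed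
  have hinter : ∀ {T U}, T ∩ U ⊆ S 0 ∨ T ∩ U ⊆ S 1 →
      drawingOn φ T ∩ drawingOn φ U ⊆ drawingOn φ (S 0) ∪ drawingOn φ (S 1) := fun h =>
    h.elim (fun h => (drawingOn_inter_subset h).trans subset_union_left)
      fun h => (drawingOn_inter_subset h).trans subset_union_right
  have hdiff : ∀ {T U z}, z ∈ drawingOn φ T \ (drawingOn φ (S 0) ∪ drawingOn φ (S 1)) →
      (T ∩ U ⊆ S 0 ∨ T ∩ U ⊆ S 1) → z ∈ φ.drawing \ drawingOn φ U := fun hz h =>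
    ⟨drawingOn_subset_drawing hz.1, fun hzU => hz.2 (hinter h ⟨hz.1, hzU⟩)⟩
  have hpath : ∀ k, IsLogBranch (drawingOn φ (S 0 ∪ S k) ∪ drawingOn φ (S k ∪ S 1))
      (φ.point (s 0)) (φ.point (s 1)) fun z => f 0 k z + f k 1 z := fun k =>
    ((hf 0 k).mono subset_union_left).add ((hf k 1).mono subset_union_right)
      (.inl (point_mem_drawingOn.2 (.inr (hs k))))
  refine isLogBranch_medianLog_of_theta ((hclosed _).union (hclosed _))
    ((hclosed _).union (hclosed _)) (hclosed _) (hpath 2) (hpath 3) (hf 0 1)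
    (.inl (point_mem_drawingOn.2 (.inl (hs 0)))) (.inr (point_mem_drawingOn.2 (.inr (hs 1))))
    ?_ ?_ ?_ ?_ ?_ ?_
  · rintro z ⟨hz | hz, hz' | hz'⟩ <;> exact hinter (by grind) ⟨hz, hz'⟩
  · rintro z ⟨hz | hz, hz'⟩ <;> exact hinter (by grind) ⟨hz, hz'⟩
  · rintro z ⟨hz | hz, hz'⟩ <;> exact hinter (by grind) ⟨hz, hz'⟩
  · rintro z ⟨hz | hz, hz'⟩ <;> exact cocycle 0 3 1 (hdiff ⟨hz, hz'⟩ (by grind))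
  · rintro z ⟨hz | hz, hz'⟩ <;> exact cocycle 0 2 1 (hdiff ⟨hz, hz'⟩ (by grind))
  · rintro z hz
    have h₁ := cocycle 0 2 3 (hdiff hz (by grind))
    have h₂ := cocycle 2 3 1 (hdiff hz (by grind))
    simp only at h₁ h₂ ⊢
    linear_combination h₁ - h₂

theorem not_isMinor_of_isOuterplanar [Finite V] (hG : G.IsOuterplanar) :
    ¬ IsMinor (completeGraph (Fin 4)) G := by
  rintro ⟨S, hS⟩
  obtain ⟨φ, F, hF, hfr⟩ := hG
  choose s hs using fun i => nonempty_coe_sort.1 (hS.connected i).nonempty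
  have hconn : ∀ i j, (G.induce (S i ∪ S j)).Connected := fun i j => by
    obtain rfl | hij := eq_or_ne i j
    · rw [union_self]
      exact hS.connected i
    · exact hS.connected_union hij
  obtain ⟨f, hf, cocycle⟩ :=
    exists_isLogBranch_cocycle hF (fun v => frontier_subset_closure (hfr v)) hconn hs
  exact not_isLogBranch_union isCompact_drawingOn isCompact_drawingOn.isClosed
    (disjoint_drawingOn (hS.disjoint (by decide))) (point_mem_drawingOn.2 (hs 0))
    (point_mem_drawingOn.2 (hs 1)) (isLogBranch_of_cocycle hS.disjoint hs hf cocycle)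

end Drawing

section MinimumDegree

/-- The vertices `p 0, …, p k` form a path of length `k` in `G`; the values of `p` beyond `k` are
irrelevant. -/
structure IsPathSeq (G : SimpleGraph V) (k : ℕ) (p : ℕ → V) : Prop where
  injOn : InjOn p (Iic k)
  adj : ∀ j < k, G.Adj (p j) (p (j + 1))

variable {k i j l m n m' n' : ℕ} {p : ℕ → V}

theorem isMinor_completeGraph_of_lt [LinearOrder W] {S : W → Set V}
    (hconn : ∀ i, (G.induce (S i)).Connected) (hdisj : ∀ i j, i < j → Disjoint (S i) (S j))
    (hadj : ∀ i j, i < j → ∃ x ∈ S i, ∃ y ∈ S j, G.Adj x y) :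
    IsMinor (completeGraph W) G := by
  refine ⟨S, hconn, fun i j hij => ?_, fun i j (hij : i ≠ j) => ?_⟩ <;>
    rcases hij.lt_or_gt with h | h
  · exact hdisj i j h
  · exact (hdisj j i h).symm
  · exact hadj i j h
  · obtain ⟨x, hx, y, hy, hxy⟩ := hadj j i h
    exact ⟨y, hy, x, hx, hxy.symm⟩

namespace IsPathSeq

theorem lt_card [Finite V] (h : IsPathSeq G k p) : k < Nat.card V := by
  have hcard := ncard_le_card (p '' Iic k)
  rw [h.injOn.ncard_image, ← Finset.coe_Iic, ncard_coe_finset, Nat.card_Iic] at hcard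
  exact hcard

theorem connected_image_Icc (h : IsPathSeq G k p) (hmn : m ≤ n) (hn : n ≤ k) :
    (G.induce (p '' Icc m n)).Connected := by
  induction n, hmn using Nat.le_induction with
  | base =>
    rw [Icc_self, image_singleton, induce_singleton_eq_top]
    exact connected_top
  | succ n hmn ih =>
    have hsplit : Icc m (n + 1) = Icc m n ∪ {n + 1} := by grind
    rw [hsplit, image_union, image_singleton]
    exact connected_induce_union (ih (by lia)).preconnected (by simp)
      (mem_image_of_mem p (right_mem_Icc.2 hmn)) rfl (h.adj n hn)

theorem disjoint_image_Icc (h : IsPathSeq G k p) (hnm : n < m') (hn' : n' ≤ k) :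
    Disjoint (p '' Icc m n) (p '' Icc m' n') := by
  rw [Set.disjoint_left]
  rintro _ ⟨x, hx, rfl⟩ ⟨y, hy, hxy⟩
  have := h.injOn (mem_Iic.2 (hy.2.trans hn')) (mem_Iic.2 (by grind)) hxy
  grind

theorem cons (h : IsPathSeq G k p) {y : V} (hy : G.Adj y (p 0)) (hyp : ∀ j ≤ k, y ≠ p j) :
    IsPathSeq G (k + 1) (fun j => if j = 0 then y else p (j - 1)) := by
  have hinj := h.injOn
  constructor
  · intro i hi j hj hij
    have := @hinj (i - 1) (by grind) (j - 1) (by grind)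
    grind
  · rintro (_ | j) hj
    · exact hy
    · exact h.adj j (by lia)

theorem rotate (h : IsPathSeq G k p) (hik : i ≤ k) (h0 : G.Adj (p 0) (p i)) :
    IsPathSeq G k (fun j => if j < i then p (i - 1 - j) else p j) := by
  have hinj : ∀ x ≤ k, ∀ y ≤ k, p x = p y → x = y := fun x hx y hy => h.injOn hx hy
  constructor
  · intro x (hx : x ≤ k) y (hy : y ≤ k) hxy
    grind
  · intro j hj
    rcases lt_trichotomy (j + 1) i with h1 | h1 | h1
    · have := (h.adj (i - 1 - (j + 1)) (by lia)).symm
      grind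
    · grind
    · have := h.adj j hj
      grind

theorem isMinor_of_chords (h : IsPathSeq G k p) (hi : 2 ≤ i) (hij : i < j) (hj : j ≤ k)
    (hil : i < l) (hl : l ≤ k) (h0i : G.Adj (p 0) (p i)) (h0j : G.Adj (p 0) (p j))
    (hl' : G.Adj (p (i - 1)) (p l)) : IsMinor (completeGraph (Fin 4)) G := by
  have hmem {m n r : ℕ} (hm : m ≤ r) (hn : r ≤ n) : p r ∈ p '' Icc m n := ⟨r, ⟨hm, hn⟩, rfl⟩
  have hpath {r : ℕ} (hr : 0 < r) (hrk : r ≤ k) : G.Adj (p (r - 1)) (p r) := by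
    simpa [Nat.sub_add_cancel hr] using h.adj (r - 1) (by lia)
  refine isMinor_completeGraph_of_lt
    (S := ![p '' Icc 0 0, p '' Icc 1 (i - 1), p '' Icc i i, p '' Icc (i + 1) k]) ?_ ?_ ?_
  · simp only [Fin.forall_fin_succ, IsEmpty.forall_iff, and_true]
    exact ⟨h.connected_image_Icc le_rfl (by lia), h.connected_image_Icc (by lia) (by lia),
      h.connected_image_Icc le_rfl (by lia), h.connected_image_Icc (by lia) le_rfl⟩
  · intro a b hab
    fin_cases a <;> fin_cases b <;> first
      | exact absurd hab (by decide)
      | exact h.disjoint_image_Icc (by lia) (by lia)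
  · intro a b hab
    fin_cases a <;> fin_cases b <;> try exact absurd hab (by decide)
    · exact ⟨p 0, hmem le_rfl le_rfl, p 1, hmem le_rfl (by lia), h.adj 0 (by lia)⟩
    · exact ⟨p 0, hmem le_rfl le_rfl, p i, hmem le_rfl le_rfl, h0i⟩
    · exact ⟨p 0, hmem le_rfl le_rfl, p j, hmem hij hj, h0j⟩
    · exact ⟨p (i - 1), hmem (by lia) le_rfl, p i, hmem le_rfl le_rfl, hpath (by lia) (by lia)⟩
    · exact ⟨p (i - 1), hmem (by lia) le_rfl, p l, hmem hil hl, hl'⟩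
    · exact ⟨p i, hmem le_rfl le_rfl, p (i + 1), hmem le_rfl (by lia), h.adj i (by lia)⟩

end IsPathSeq

theorem exists_maximal_isPathSeq [Finite V] {x y : V} (hxy : G.Adj x y) :
    ∃ k p, 1 ≤ k ∧ IsPathSeq G k p ∧ ∀ q, ¬ IsPathSeq G (k + 1) q := by
  classical
  let P : ℕ → Prop := fun k => 1 ≤ k ∧ ∃ p, IsPathSeq G k p
  have hP : P 1 := by
    refine ⟨le_rfl, fun j => if j = 0 then x else y, ?_, by simpa using hxy⟩
    have := hxy.ne
    intro i (hi : i ≤ 1) j (hj : j ≤ 1) hij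
    grind
  have hbound (k : ℕ) (hk : P k) : k ≤ Nat.card V := by
    obtain ⟨-, p, hp⟩ := hk
    exact hp.lt_card.le
  obtain ⟨hk, p, hp⟩ := Nat.findGreatest_spec (hbound 1 hP) hP
  refine ⟨_, p, hk, hp, fun q hq => ?_⟩
  have hle := Nat.le_findGreatest (P := P) hq.lt_card.le ⟨by lia, q, hq⟩
  lia

theorem exists_chord (hk : 1 ≤ k) (hmax : ∀ q, ¬ IsPathSeq G (k + 1) q)
    (hdeg : ∀ v u w, G.Adj v u → G.Adj v w → ∃ x, G.Adj v x ∧ x ≠ u ∧ x ≠ w)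
    (hp : IsPathSeq G k p) (hi : G.Adj (p 0) (p i)) :
    ∃ j ≤ k, 2 ≤ j ∧ j ≠ i ∧ G.Adj (p 0) (p j) := by
  obtain ⟨y, hy, hy1, hyi⟩ := hdeg (p 0) (p 1) (p i) (hp.adj 0 hk) hi
  obtain ⟨j, hj, rfl⟩ : ∃ j ≤ k, y = p j := by
    by_contra! hcon
    exact hmax _ (hp.cons hy.symm hcon)
  have h0 : j ≠ 0 := fun h => hy.ne (by rw [h])
  have h1 : j ≠ 1 := fun h => hy1 (by rw [h])
  exact ⟨j, hj, by lia, fun h => hyi (by rw [h]), hy⟩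

/-- Among all longest paths, take one whose first vertex has its first chord as short as possible,
ending at `p i` say. Reversing `p 0, …, p (i - 1)` gives a longest path that starts at `p (i - 1)`,
so this vertex has a chord to beyond `p i` as well. -/
theorem isMinor_completeGraph_of_two_lt_degree [Finite V] {x y : V} (hxy : G.Adj x y)
    (hdeg : ∀ v u w, G.Adj v u → G.Adj v w → ∃ x, G.Adj v x ∧ x ≠ u ∧ x ≠ w) :
    IsMinor (completeGraph (Fin 4)) G := by
  classical
  obtain ⟨k, p₀, hk, hp₀, hmax⟩ := exists_maximal_isPathSeq hxy
  have hex : ∃ i, ∃ p, IsPathSeq G k p ∧ 2 ≤ i ∧ i ≤ k ∧ G.Adj (p 0) (p i) := by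
    obtain ⟨j, hj, hj2, -, hadj⟩ := exists_chord hk hmax hdeg hp₀ (hp₀.adj 0 hk)
    exact ⟨j, p₀, hp₀, hj2, hj, hadj⟩
  obtain ⟨p, hp, hi, hik, h0i⟩ := Nat.find_spec hex
  set i := Nat.find hex
  have hmin {q : ℕ → V} (hq : IsPathSeq G k q) (hqi : G.Adj (q 0) (q i)) :
      ∃ j ≤ k, i < j ∧ G.Adj (q 0) (q j) := by
    obtain ⟨j, hj, hj2, hji, hadj⟩ := exists_chord hk hmax hdeg hq hqi
    have hij : i ≤ j := Nat.find_min' hex ⟨q, hq, hj2, hj, hadj⟩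
    exact ⟨j, hj, hij.lt_of_ne' hji, hadj⟩
  obtain ⟨j, hj, hij, h0j⟩ := hmin hp h0i
  have hlast : G.Adj (p (i - 1)) (p i) := by
    simpa [show i - 1 + 1 = i by lia] using hp.adj (i - 1) (by lia)
  obtain ⟨l, hl, hil, hl'⟩ := hmin (hp.rotate hik h0i) (by simpa [show 0 < i by lia] using hlast)
  refine hp.isMinor_of_chords hi hij hj hil hl h0i h0j ?_
  simpa [show 0 < i by lia, hil.not_gt] using hl'

end MinimumDegree

section Suppress

variable {H M : SimpleGraph W} {S : W → Set V} {v u w x y : V} {i j : W}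

theorem reachable_of_forall_adj {f : W → V} (hf : ∀ x y, M.Adj x y → G.Reachable (f x) (f y))
    (h : M.Reachable i j) : G.Reachable (f i) (f j) := by
  simp only [reachable_iff_reflTransGen] at hf h ⊢
  exact h.lift' f hf

/-- The graph obtained from `G` by deleting the edges at `v` and joining `u` and `w` (unless
`u = w`). When `u` and `w` are the neighbours of `v`, this suppresses the vertex `v`; it remains as
an isolated vertex, so that the vertex type does not change. -/
def suppress (G : SimpleGraph V) (v u w : V) : SimpleGraph V :=
  G.deleteIncidenceSet v ⊔ edge u w

theorem suppress_adj : (suppress G v u w).Adj x y ↔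
    (G.Adj x y ∧ x ≠ v ∧ y ≠ v) ∨ (x = u ∧ y = w ∨ x = w ∧ y = u) ∧ x ≠ y := by
  rw [suppress, sup_adj, deleteIncidenceSet_adj, edge_adj]

theorem suppress_comm : suppress G v u w = suppress G v w u := by
  rw [suppress, edge_comm, ← suppress]

theorem ne_of_suppress_adj (hu : G.Adj v u) (hw : G.Adj v w) (h : (suppress G v u w).Adj x y) :
    x ≠ v := by
  have := hu.ne
  have := hw.ne
  grind [suppress_adj]

theorem ncard_support_lt [Finite V] {G' : SimpleGraph V} (hu : G.Adj v u)
    (h : ∀ x y, G'.Adj x y → x ≠ v ∧ x ∈ G.support) : G'.support.ncard < G.support.ncard := by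
  refine ncard_lt_ncard ⟨fun x ⟨y, hxy⟩ => (h x y hxy).2, fun hsub => ?_⟩
  obtain ⟨y, hy⟩ := hsub (G.mem_support.2 ⟨u, hu⟩)
  exact (h v y hy).1 rfl

theorem ncard_support_deleteIncidenceSet_lt [Finite V] (hu : G.Adj v u) :
    (G.deleteIncidenceSet v).support.ncard < G.support.ncard := by
  refine ncard_support_lt hu fun x y hxy => ?_
  obtain ⟨hadj, hx, -⟩ := deleteIncidenceSet_adj.1 hxy
  exact ⟨hx, y, hadj⟩

theorem ncard_support_suppress_lt [Finite V] (hu : G.Adj v u) (hw : G.Adj v w) :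
    (suppress G v u w).support.ncard < G.support.ncard := by
  refine ncard_support_lt hu fun x y hxy => ⟨ne_of_suppress_adj hu hw hxy, ?_⟩
  rcases suppress_adj.1 hxy with h | ⟨⟨rfl, rfl⟩ | ⟨rfl, rfl⟩, -⟩
  exacts [⟨y, h.1⟩, ⟨v, hu.symm⟩, ⟨v, hw.symm⟩]

theorem IsMinor.mono {G' : SimpleGraph V} (h : IsMinor H G) (hle : G ≤ G') : IsMinor H G' := by
  obtain ⟨S, hS⟩ := h
  refine ⟨S, fun i => (hS.connected i).mono fun _ _ hxy => hle hxy, hS.disjoint, fun i j hij => ?_⟩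
  obtain ⟨x, hx, y, hy, hxy⟩ := hS.exists_adj hij
  exact ⟨x, hx, y, hy, hle hxy⟩

theorem IsMinorModel.exists_adj_of_mem (h : IsMinorModel H G S) (hij : H.Adj i j)
    (hv : v ∈ S i) : ∃ x, G.Adj v x := by
  obtain ⟨x, hx, y, -, hxy⟩ := h.exists_adj hij
  by_cases hvx : v = x
  · exact ⟨y, hvx ▸ hxy⟩
  · have hreach := (h.connected i).preconnected ⟨v, hv⟩ ⟨x, hx⟩
    obtain ⟨z, hz⟩ := hreach.nonempty_neighborSet_left (by simpa using hvx)
    exact ⟨z, hz⟩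

theorem connected_induce_insert_of_suppress {S : Set V} (hu : G.Adj v u) (hw : G.Adj v w)
    (huS : u ∈ S) (hS : ((suppress G v u w).induce S).Connected) :
    (G.induce (insert v S)).Connected := by
  have hv {z : V} (hz : G.Adj v z) (hzS : z ∈ S) :
      (G.induce (insert v S)).Reachable ⟨v, mem_insert v S⟩ ⟨z, mem_insert_of_mem v hzS⟩ :=
    Adj.reachable hz
  have hedge (x y : S) (hxy : ((suppress G v u w).induce S).Adj x y) :
      (G.induce (insert v S)).Reachable ⟨x, mem_insert_of_mem v x.2⟩
        ⟨y, mem_insert_of_mem v y.2⟩ := by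
    obtain ⟨x, hx⟩ := x
    obtain ⟨y, hy⟩ := y
    rcases suppress_adj.1 hxy with h | ⟨⟨rfl, rfl⟩ | ⟨rfl, rfl⟩, -⟩
    · exact Adj.reachable h.1
    · exact (hv hu hx).symm.trans (hv hw hy)
    · exact (hv hw hx).symm.trans (hv hu hy)
  refine connected_iff_exists_forall_reachable _ |>.2 ⟨⟨v, mem_insert v S⟩, ?_⟩
  rintro ⟨y, rfl | hy⟩
  · rfl
  · exact (hv hu huS).trans
      (reachable_of_forall_adj hedge (hS.preconnected ⟨u, huS⟩ ⟨y, hy⟩))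

theorem isMinor_of_suppress (hH : ∀ i, ∃ j, H.Adj i j) (hu : G.Adj v u) (hw : G.Adj v w)
    (h : IsMinor H (suppress G v u w)) : IsMinor H G := by
  classical
  obtain ⟨S, hS⟩ := h
  have hvS (i : W) : v ∉ S i := fun hv => by
    obtain ⟨j, hij⟩ := hH i
    obtain ⟨x, hx⟩ := hS.exists_adj_of_mem hij hv
    exact ne_of_suppress_adj hu hw hx rfl
  have hdisj {i j : W} (hij : i ≠ j) {x : V} (hi : x ∈ S i) : x ∉ S j :=
    Set.disjoint_left.1 (hS.disjoint hij) hi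
  refine ⟨fun i => if u ∈ S i then insert v (S i) else S i, fun i => ?_, fun i j hij => ?_,
    fun i j hij => ?_⟩
  · by_cases hui : u ∈ S i
    · rw [if_pos hui]
      exact connected_induce_insert_of_suppress hu hw hui (hS.connected i)
    · rw [if_neg hui]
      refine (hS.connected i).mono fun x y hxy => ?_
      rcases suppress_adj.1 hxy with h | ⟨⟨hx, -⟩ | ⟨-, hy⟩, -⟩
      exacts [h.1, absurd (hx ▸ x.2) hui, absurd (hy ▸ y.2) hui]
  · refine Set.disjoint_left.2 fun x hxi hxj => ?_
    grind
  · obtain ⟨x, hx, y, hy, hxy⟩ := hS.exists_adj hij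
    rcases suppress_adj.1 hxy with h | ⟨⟨rfl, rfl⟩ | ⟨rfl, rfl⟩, -⟩
    · exact ⟨x, by grind, y, by grind, h.1⟩
    · exact ⟨v, by grind, y, by grind, hw⟩
    · exact ⟨x, by grind, v, by grind, hw.symm⟩

end Suppress

section Forcing

variable {G' : SimpleGraph V} {C S : Set V} {L : List (V × V)} {p q v u w x y : V}

/-- The graph `G \ S` of the colour change rule, when `S` is the set of black vertices. It keeps the
vertices in `S` as isolated vertices, so that the vertex type does not change. -/
def whiteGraph (G : SimpleGraph V) (S : Set V) : SimpleGraph V :=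
  (G.induce Sᶜ).spanningCoe

theorem whiteGraph_adj : (whiteGraph G S).Adj x y ↔ G.Adj x y ∧ x ∉ S ∧ y ∉ S := by
  simp [whiteGraph]

theorem reachable_induce_compl_iff (hx : x ∈ Sᶜ) (hy : y ∈ Sᶜ) :
    (G.induce Sᶜ).Reachable ⟨x, hx⟩ ⟨y, hy⟩ ↔ (whiteGraph G S).Reachable x y := by
  refine ⟨fun h => h.map (Embedding.spanningCoe (G.induce Sᶜ)).toHom, ?_⟩
  rintro ⟨r⟩
  induction r with
  | nil => rfl
  | cons h _ ih =>
    obtain ⟨hadj, -, hz⟩ := whiteGraph_adj.1 h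
    exact (show (G.induce Sᶜ).Adj ⟨_, hx⟩ ⟨_, hz⟩ from hadj).reachable.trans (ih hz hy)

theorem positiveForces_iff : G.PositiveForces S p q ↔ p ∈ S ∧ q ∉ S ∧ G.Adj p q ∧
    ∀ x, G.Adj p x → x ∉ S → (whiteGraph G S).Reachable q x → x = q := by
  constructor
  · rintro ⟨hp, K, hK⟩
    obtain ⟨hpq, hq, rfl⟩ := hK.superset (mem_singleton q)
    refine ⟨hp, hq, hpq, fun x hpx hx hqx => hK.subset ⟨hpx, hx, ?_⟩⟩
    exact ConnectedComponent.sound ((reachable_induce_compl_iff hx hq).2 hqx.symm)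
  · rintro ⟨hp, hq, hpq, huniq⟩
    refine ⟨hp, (G.induce Sᶜ).connectedComponentMk ⟨q, hq⟩, subset_antisymm ?_ ?_⟩
    · rintro x ⟨hpx, hx, hxq⟩
      refine huniq x hpx hx ?_
      exact ((reachable_induce_compl_iff hx hq).1 (ConnectedComponent.exact hxq)).symm
    · rintro _ rfl
      exact ⟨hpq, hq, rfl⟩

theorem suppress_adj_of_mem_pair (hx : x = u ∨ x = w) (hy : y = u ∨ y = w) (hxy : x ≠ y) :
    (suppress G v u w).Adj x y := by
  grind [suppress_adj]

theorem reachable_whiteGraph_suppress (hu : G.Adj v u) (hw : G.Adj v w)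
    (hN : ∀ x, G.Adj v x → x = u ∨ x = w) (hx : x ≠ v) (hy : y ≠ v)
    (h : (whiteGraph G S).Reachable x y) :
    (whiteGraph (suppress G v u w) (insert v S)).Reachable x y := by
  classical
  let z : V := if u ∈ S then w else u
  let f : V → V := Function.update id v z
  have hv (y : V) (hvy : (whiteGraph G S).Adj v y) :
      (whiteGraph (suppress G v u w) (insert v S)).Reachable z y := by
    obtain ⟨hadj, -, hyS⟩ := whiteGraph_adj.1 hvy
    by_cases hzy : z = y
    · rw [hzy]
    · refine Adj.reachable (whiteGraph_adj.2 ⟨?_, ?_, ?_⟩)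
      · exact suppress_adj_of_mem_pair (by grind) (hN y hadj) hzy
      · have := hu.ne
        have := hw.ne
        grind
      · have := hadj.ne
        grind
  have key (a b : V) (hab : (whiteGraph G S).Adj a b) :
      (whiteGraph (suppress G v u w) (insert v S)).Reachable (f a) (f b) := by
    by_cases ha : a = v
    · subst ha
      simpa [f, hab.ne'] using hv b hab
    · by_cases hb : b = v
      · subst hb
        simpa [f, hab.ne] using (hv a hab.symm).symm
      · refine Adj.reachable ?_
        simp only [f, Function.update_of_ne ha, Function.update_of_ne hb, id]
        grind [whiteGraph_adj, suppress_adj]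
  simpa [f, hx, hy] using reachable_of_forall_adj key h

theorem positiveForces_of_suppress (hu : G.Adj v u) (hw : G.Adj v w)
    (hN : ∀ x, G.Adj v x → x = u ∨ x = w) (h : (suppress G v u w).PositiveForces (insert v S) p q)
    (huw : ¬ (p = u ∧ q = w)) (hwu : ¬ (p = w ∧ q = u)) : G.PositiveForces S p q := by
  rw [positiveForces_iff] at h ⊢
  obtain ⟨hp, hq, hpq, huniq⟩ := h
  have hpv : p ≠ v := ne_of_suppress_adj hu hw hpq
  have hqv : q ≠ v := ne_of_suppress_adj hu hw hpq.symm
  have hpS : p ∈ S := hp.resolve_left hpv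
  refine ⟨hpS, fun hqS => hq (.inr hqS), by grind [suppress_adj], fun x hpx hx hqx => ?_⟩
  by_cases hxv : x = v
  · -- The component of `q` enters `v` through a white neighbour `z`; it is joined to `p` by the
    -- new edge, so it is `q`.
    subst hxv
    obtain ⟨z, hz⟩ := hqx.symm.nonempty_neighborSet_left hqv.symm
    obtain ⟨hxz, -, hzS⟩ := whiteGraph_adj.1 hz
    have hpz : p ≠ z := fun h => hzS (h ▸ hpS)
    have hpuw := hN p hpx.symm
    have hzuw := hN z hxz
    have hzq : z = q := huniq z (suppress_adj_of_mem_pair hpuw hzuw hpz)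
      (fun h => h.elim hxz.ne' hzS)
      (reachable_whiteGraph_suppress hu hw hN hqv hxz.ne' (hqx.trans hz.reachable))
    grind
  · exact huniq x (suppress_adj.2 (.inl ⟨hpx, hpv, hxv⟩)) (fun h => h.elim hxv hx)
      (reachable_whiteGraph_suppress hu hw hN hqv hxv hqx)

theorem positiveForces_subdivision (hu : G.Adj v u) (hw : G.Adj v w)
    (hN : ∀ x, G.Adj v x → x = u ∨ x = w) (hv : v ∉ S) (huw : ¬ G.Adj u w)
    (h : (suppress G v u w).PositiveForces (insert v S) u w) :
    G.PositiveForces S u v ∧ G.PositiveForces (insert v S) v w := by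
  rw [positiveForces_iff] at h
  obtain ⟨huS, hwS, -, huniq⟩ := h
  have hu' : u ∈ S := huS.resolve_left hu.ne'
  refine ⟨positiveForces_iff.2 ⟨hu', hv, hu.symm, fun x hux hx hvx => ?_⟩,
    positiveForces_iff.2 ⟨.inl rfl, hwS, hw, by grind⟩⟩
  by_contra hxv
  have hwv : (whiteGraph G S).Adj w v := whiteGraph_adj.2 ⟨hw.symm, fun h => hwS (.inr h), hv⟩
  have hxw : x = w := huniq x (suppress_adj.2 (.inl ⟨hux, hu.ne', hxv⟩)) (by grind)
    (reachable_whiteGraph_suppress hu hw hN hw.ne' hxv (hwv.reachable.trans hvx))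
  exact huw (hxw ▸ hux)

theorem positiveForcing_of_forall_adj (h : G'.PositiveForcing S L C) (hv : v ∈ S)
    (hle : G.deleteIncidenceSet v ≤ G')
    (hadj : ∀ x y, G'.Adj x y → x ≠ v ∧ (G.Adj x y ∨ x ∈ S ∧ y ∈ S)) :
    G.PositiveForcing S L C := by
  induction h with
  | nil B => exact .nil B
  | @cons B C p q L h hL ih =>
    refine .cons ?_ (ih (.inr hv) fun x y hxy =>
      ⟨(hadj x y hxy).1, (hadj x y hxy).2.imp_right fun h => ⟨.inr h.1, .inr h.2⟩⟩)
    rw [positiveForces_iff] at h ⊢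
    obtain ⟨hp, hq, hpq, huniq⟩ := h
    obtain ⟨hpv, hpq'⟩ := hadj p q hpq
    have hwhite : whiteGraph G B ≤ whiteGraph G' B := fun a b hab => by
      obtain ⟨hab, ha, hb⟩ := whiteGraph_adj.1 hab
      refine whiteGraph_adj.2 ⟨hle (deleteIncidenceSet_adj.2 ⟨hab, ?_, ?_⟩), ha, hb⟩ <;>
        grind
    refine ⟨hp, hq, hpq'.resolve_right fun h => hq h.2, fun x hpx hx hqx => ?_⟩
    refine huniq x (hle (deleteIncidenceSet_adj.2 ⟨hpx, hpv, ?_⟩)) hx (hqx.mono hwhite)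
    exact fun hxv => hx (hxv ▸ hv)

end Forcing

section Colouring

variable {ι : Type*} {c : V → ι} {B S : Set V} {L : List (V × V)} {p q u v w : V}

/-- The edges of `G` with both ends of the same colour. -/
def monochromatic (G : SimpleGraph V) (c : V → ι) : SimpleGraph V where
  Adj x y := G.Adj x y ∧ c x = c y
  symm := ⟨fun _ _ h => ⟨h.1.symm, h.2.symm⟩⟩
  loopless := ⟨fun _ h => h.1.ne rfl⟩

/-- A colouring of the vertices such that each colour class induces a tree. This is how a tree
covering is carried along when the graph is changed. -/
structure IsTreeColouring (G : SimpleGraph V) (c : V → ι) : Prop where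
  isAcyclic : (monochromatic G c).IsAcyclic
  reachable : ∀ x y, c x = c y → (monochromatic G c).Reachable x y

/-- The forces in `L` turn all vertices black, starting from `B`, and each of them is applied
between two vertices of the same colour. -/
structure IsColourForcing (G : SimpleGraph V) (c : V → ι) (B : Set V) (L : List (V × V)) :
    Prop where
  forcing : G.PositiveForcing B L univ
  colour_eq : ∀ e ∈ L, c e.1 = c e.2

/-- The colouring in which the colour of `v` is changed to a new colour. -/
def isolateColour [DecidableEq V] (c : V → ι) (v : V) : V → Option ι :=
  fun x => if x = v then none else some (c x)

theorem not_reachable_deleteIncidenceSet (hG : G.IsAcyclic) (hu : G.Adj v u) (hw : G.Adj v w)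
    (huw : u ≠ w) : ¬ (G.deleteIncidenceSet v).Reachable u w := by
  intro h
  have hle : G.deleteIncidenceSet v ≤ G \ fromEdgeSet {s(v, u)} := fun x y hxy => by
    obtain ⟨hxy, hx, hy⟩ := deleteIncidenceSet_adj.1 hxy
    exact ⟨hxy, by simp [hx, hy]⟩
  have hvw : (G \ fromEdgeSet {s(v, u)}).Adj v w := ⟨hw, by simp [huw.symm, hu.ne]⟩
  exact isBridge_iff.1 (isAcyclic_iff_forall_adj_isBridge.1 hG hu)
    (hvw.reachable.trans (h.mono hle).symm)

theorem isAcyclic_suppress (hG : G.IsAcyclic) (hu : G.Adj v u) (hw : G.Adj v w) :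
    (suppress G v u w).IsAcyclic := by
  have hdel := hG.anti (G.deleteIncidenceSet_le v)
  by_cases huw : u = w
  · simpa [suppress, huw] using hdel
  · exact hdel.sup_edge_of_not_reachable (not_reachable_deleteIncidenceSet hG hu hw huw)

theorem not_adj_of_isAcyclic (hG : G.IsAcyclic) (hu : G.Adj v u) (hw : G.Adj v w) :
    ¬ G.Adj u w := fun huw =>
  not_reachable_deleteIncidenceSet hG hu hw huw.ne
    (deleteIncidenceSet_adj.2 ⟨huw, hu.ne', hw.ne'⟩).reachable

namespace IsColourForcing

theorem cons (h : IsColourForcing G c (insert q B) L) (hpq : G.PositiveForces B p q)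
    (hc : c p = c q) : IsColourForcing G c B ((p, q) :: L) :=
  ⟨.cons hpq h.forcing, List.forall_mem_cons.2 ⟨hc, h.colour_eq⟩⟩

theorem of_deleteIncidenceSet (h : IsColourForcing (G.deleteIncidenceSet v) c B L) (hv : v ∈ B) :
    IsColourForcing G c B L := by
  refine ⟨positiveForcing_of_forall_adj h.forcing hv le_rfl fun x y hxy => ?_, h.colour_eq⟩
  obtain ⟨hxy, hx, -⟩ := deleteIncidenceSet_adj.1 hxy
  exact ⟨hx, .inl hxy⟩

theorem subdivision (h : IsColourForcing (suppress G v u w) c (insert w (insert v S)) L)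
    (hu : G.Adj v u) (hw : G.Adj v w) (hN : ∀ x, G.Adj v x → x = u ∨ x = w) (hv : v ∉ S)
    (huw : ¬ G.Adj u w) (hcu : c u = c v) (hcw : c v = c w)
    (hf : (suppress G v u w).PositiveForces (insert v S) u w) :
    IsColourForcing G c S ((u, v) :: (v, w) :: L) := by
  obtain ⟨huv, hvw⟩ := positiveForces_subdivision hu hw hN hv huw hf
  have huS : u ∈ S := huv.1
  have hL : G.PositiveForcing (insert w (insert v S)) L univ := by
    refine positiveForcing_of_forall_adj h.forcing (.inr (.inl rfl)) le_sup_left fun x y hxy =>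
      ⟨ne_of_suppress_adj hu hw hxy, ?_⟩
    grind [suppress_adj]
  exact .cons (.cons ⟨hL, h.colour_eq⟩ hvw hcw) huv hcu

/-- A force across the new edge of the suppressed graph is replaced by two forces through `v`; if
there is none, `v` is forced at the end. -/
theorem exists_of_suppress (h : IsColourForcing (suppress G v u w) c (insert v S) L)
    (hu : G.Adj v u) (hw : G.Adj v w) (hN : ∀ x, G.Adj v x → x = u ∨ x = w) (hv : v ∉ S)
    (hcu : c u = c v) (huw : c u = c w → ¬ G.Adj u w) : ∃ L', IsColourForcing G c S L' := by
  induction L generalizing S with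
  | nil =>
    obtain ⟨hforcing, -⟩ := h
    have huniv : insert v S = univ := by
      generalize insert v S = T at hforcing
      cases hforcing
      rfl
    have hmem (x : V) (hx : x ∉ S) : x = v := by grind
    have huS : u ∈ S := by_contra fun huS => hu.ne' (hmem u huS)
    refine ⟨[(u, v)], .cons ⟨?_, by simp⟩ (positiveForces_iff.2 ⟨huS, hv, hu.symm, by grind⟩) hcu⟩
    exact huniv ▸ .nil _
  | cons e L ih =>
    obtain ⟨p, q⟩ := e
    obtain ⟨hforcing, hcolour⟩ := h
    obtain ⟨hcpq, hcL⟩ := List.forall_mem_cons.1 hcolour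
    cases hforcing with | cons hpq hL =>
    by_cases h1 : p = u ∧ q = w
    · obtain ⟨rfl, rfl⟩ := h1
      exact ⟨_, subdivision ⟨hL, hcL⟩ hu hw hN hv (huw hcpq) hcu (hcu.symm.trans hcpq) hpq⟩
    by_cases h2 : p = w ∧ q = u
    · obtain ⟨rfl, rfl⟩ := h2
      rw [suppress_comm] at hpq hL
      exact ⟨_, subdivision ⟨hL, hcL⟩ hw hu (fun x hx => (hN x hx).symm) hv
        (fun h => huw hcpq.symm h.symm) (hcpq.trans hcu) hcu.symm hpq⟩
    have hqv : q ≠ v := fun hqv => (positiveForces_iff.1 hpq).2.1 (.inl hqv)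
    rw [insert_comm] at hL
    obtain ⟨L', hL'⟩ := ih ⟨hL, hcL⟩ (by grind)
    exact ⟨_, hL'.cons (positiveForces_of_suppress hu hw hN hpq h1 h2) hcpq⟩

end IsColourForcing

theorem isolateColour_eq_iff [DecidableEq V] {x y : V} : isolateColour c v x = isolateColour c v y ↔
    (x = v ↔ y = v) ∧ c x = c y := by
  grind [isolateColour]

namespace IsTreeColouring

theorem deleteIncidenceSet (h : IsTreeColouring G c) (hv : ∀ x, c x = c v → x = v) :
    IsTreeColouring (G.deleteIncidenceSet v) c := by
  have heq : monochromatic (G.deleteIncidenceSet v) c = monochromatic G c := by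
    ext x y
    have hne : G.Adj x y → x ≠ y := Adj.ne
    simp only [monochromatic, deleteIncidenceSet_adj]
    grind
  exact ⟨heq ▸ h.isAcyclic, heq ▸ h.reachable⟩

theorem exists_adj_of_ne (h : IsTreeColouring G c) {x : V} (hx : c x = c v) (hxv : x ≠ v) :
    ∃ u, G.Adj v u ∧ c u = c v := by
  obtain ⟨u, hu⟩ := (h.reachable v x hx.symm).nonempty_neighborSet_left hxv.symm
  exact ⟨u, hu.1, hu.2.symm⟩

theorem isAcyclic_monochromatic_suppress [DecidableEq V] (h : IsTreeColouring G c)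
    (hu : G.Adj v u) (hw : G.Adj v w) (hcu : c u = c v) :
    (monochromatic (suppress G v u w) (isolateColour c v)).IsAcyclic := by
  by_cases hcw : c w = c v
  · refine (isAcyclic_suppress h.isAcyclic (w := w) ⟨hu, hcu.symm⟩ ⟨hw, hcw.symm⟩).anti ?_
    rintro x y ⟨hxy, hc⟩
    rw [isolateColour_eq_iff] at hc
    exact suppress_adj.2 ((suppress_adj.1 hxy).imp_left fun h => ⟨⟨h.1, hc.2⟩, h.2⟩)
  · refine h.isAcyclic.anti ?_
    rintro x y ⟨hxy, hc⟩
    rw [isolateColour_eq_iff] at hc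
    exact ⟨by grind [suppress_adj], hc.2⟩

theorem suppress [DecidableEq V] (h : IsTreeColouring G c) (hu : G.Adj v u) (hw : G.Adj v w)
    (hN : ∀ x, G.Adj v x → x = u ∨ x = w) (hcu : c u = c v) :
    IsTreeColouring (suppress G v u w) (isolateColour c v) := by
  refine ⟨h.isAcyclic_monochromatic_suppress hu hw hcu, fun x y hxy => ?_⟩
  rw [isolateColour_eq_iff] at hxy
  by_cases hx : x = v
  · rw [hx, hxy.1.1 hx]
  have hy : y ≠ v := fun hy => hx (hxy.1.2 hy)
  let M := monochromatic (PositiveZeroForcing.suppress G v u w) (isolateColour c v)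
  let f : V → V := Function.update id v u
  have hv (y : V) (hvy : (monochromatic G c).Adj v y) : M.Reachable u y := by
    by_cases huy : u = y
    · rw [huy]
    obtain rfl : y = w := (hN y hvy.1).resolve_left (Ne.symm huy)
    refine Adj.reachable ⟨suppress_adj.2 (.inr ⟨.inl ⟨rfl, rfl⟩, huy⟩), ?_⟩
    exact isolateColour_eq_iff.2 ⟨by simp [hu.ne', hw.ne'], hcu.trans hvy.2⟩
  have key (a b : V) (hab : (monochromatic G c).Adj a b) : M.Reachable (f a) (f b) := by
    by_cases ha : a = v
    · subst ha
      simpa [f, hab.ne'] using hv b hab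
    · by_cases hb : b = v
      · subst hb
        simpa [f, hab.ne] using (hv a hab.symm).symm
      · simp only [f, Function.update_of_ne ha, Function.update_of_ne hb, id]
        exact Adj.reachable ⟨suppress_adj.2 (.inl ⟨hab.1, ha, hb⟩),
          isolateColour_eq_iff.2 ⟨by simp [ha, hb], hab.2⟩⟩
  simpa [f, hx, hy] using reachable_of_forall_adj key (h.reachable x y hxy.2)

end IsTreeColouring

theorem bijOn_of_isolateColour [DecidableEq V] (huv : u ≠ v) (hcu : c u = c v)
    (hB : BijOn (isolateColour c v) B (range (isolateColour c v))) :
    v ∈ B ∧ BijOn c (B \ {v}) (range c) := by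
  have hsurj (x : V) : ∃ r ∈ B, (r = v ↔ x = v) ∧ c r = c x := by
    obtain ⟨r, hr, hrx⟩ := hB.surjOn (mem_range_self x)
    exact ⟨r, hr, isolateColour_eq_iff.1 hrx⟩
  have hv : v ∈ B := by
    obtain ⟨r, hr, hrv, -⟩ := hsurj v
    exact hrv.2 rfl ▸ hr
  refine ⟨hv, mapsTo_range c _, fun x hx y hy hxy => ?_, ?_⟩
  · exact hB.injOn hx.1 hy.1 (isolateColour_eq_iff.2 ⟨by grind, hxy⟩)
  · rintro _ ⟨x, rfl⟩
    obtain ⟨y, hy, hxy⟩ : ∃ y, y ≠ v ∧ c y = c x := by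
      by_cases hx : x = v
      exacts [⟨u, huv, by rw [hx, hcu]⟩, ⟨x, hx, rfl⟩]
    obtain ⟨r, hr, hrv, hry⟩ := hsurj y
    exact ⟨r, ⟨hr, by grind⟩, hry.trans hxy⟩

namespace IsTreeColouring

theorem bijOn_of_not_adj (h : IsTreeColouring G c) (hG : ∀ x y, ¬ G.Adj x y) :
    BijOn c univ (range c) := by
  refine ⟨mapsTo_range c _, fun x _ y _ hxy => ?_, by simp [SurjOn]⟩
  by_contra hne
  obtain ⟨u, hu⟩ := (h.reachable x y hxy).nonempty_neighborSet_left hne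
  exact hG x u hu.1

theorem exists_isColourForcing_of_suppress [DecidableEq V] (h : IsTreeColouring G c)
    (hu : G.Adj v u) (hw : G.Adj v w) (hN : ∀ x, G.Adj v x → x = u ∨ x = w) (hcu : c u = c v)
    (hL : IsColourForcing (PositiveZeroForcing.suppress G v u w) (isolateColour c v) B L)
    (hB : BijOn (isolateColour c v) B (range (isolateColour c v))) :
    ∃ B L, IsColourForcing G c B L ∧ BijOn c B (range c) := by
  obtain ⟨hvB, hB'⟩ := bijOn_of_isolateColour hu.ne' hcu hB
  have hL' : IsColourForcing (PositiveZeroForcing.suppress G v u w) c (insert v (B \ {v})) L := by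
    rw [insert_sdiff_singleton, insert_eq_of_mem hvB]
    exact ⟨hL.forcing, fun e he => (isolateColour_eq_iff.1 (hL.colour_eq e he)).2⟩
  have huw (hc : c u = c w) (hadj : G.Adj u w) : False :=
    not_adj_of_isAcyclic h.isAcyclic (v := v) (u := u) (w := w) ⟨hu, hcu.symm⟩
      ⟨hw, hcu.symm.trans hc⟩ ⟨hadj, hc⟩
  obtain ⟨L', hL''⟩ := hL'.exists_of_suppress hu hw hN (by simp) hcu huw
  exact ⟨_, L', hL'', hB'⟩

theorem exists_isColourForcing [Finite V] (hG : ¬ IsMinor (completeGraph (Fin 4)) G)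
    (h : IsTreeColouring G c) : ∃ B L, IsColourForcing G c B L ∧ BijOn c B (range c) := by
  classical
  induction hn : G.support.ncard using Nat.strong_induction_on generalizing G ι with
  | _ n ih =>
  subst hn
  by_cases hE : ∃ x y, G.Adj x y
  swap
  · push Not at hE
    exact ⟨univ, [], ⟨.nil _, by simp⟩, h.bijOn_of_not_adj hE⟩
  obtain ⟨x, y, hxy⟩ := hE
  obtain ⟨v, u, w, hu, hw, hN⟩ : ∃ v u w, G.Adj v u ∧ G.Adj v w ∧
      ∀ x, G.Adj v x → x = u ∨ x = w := by
    by_contra! hdeg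
    exact hG (isMinor_completeGraph_of_two_lt_degree hxy hdeg)
  by_cases hv : ∀ x, c x = c v → x = v
  · obtain ⟨B, L, hL, hB⟩ := ih _ (ncard_support_deleteIncidenceSet_lt hu)
      (fun hminor => hG (hminor.mono (G.deleteIncidenceSet_le v))) (h.deleteIncidenceSet hv) rfl
    obtain ⟨r, hr, hrv⟩ := hB.surjOn (mem_range_self v)
    exact ⟨B, L, hL.of_deleteIncidenceSet (hv r hrv ▸ hr), hB⟩
  · obtain ⟨u, w, hu, hw, hN, hcu⟩ : ∃ u w, G.Adj v u ∧ G.Adj v w ∧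
        (∀ x, G.Adj v x → x = u ∨ x = w) ∧ c u = c v := by
      push Not at hv
      obtain ⟨x, hx, hxv⟩ := hv
      obtain ⟨z, hz, hcz⟩ := h.exists_adj_of_ne hx hxv
      rcases hN z hz with rfl | rfl
      exacts [⟨z, w, hz, hw, hN, hcz⟩, ⟨z, u, hz, hu, fun x hx => (hN x hx).symm, hcz⟩]
    have hminor : ¬ IsMinor (completeGraph (Fin 4)) (PositiveZeroForcing.suppress G v u w) :=
      mt (isMinor_of_suppress (fun i => (exists_ne i).imp fun _ => Ne.symm) hu hw) hG
    obtain ⟨B, L, hL, hB⟩ :=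
      ih _ (ncard_support_suppress_lt hu hw) hminor (h.suppress hu hw hN hcu) rfl
    exact h.exists_isColourForcing_of_suppress hu hw hN hcu hL hB

end IsTreeColouring

end Colouring

section ForcingTree

variable {ι : Type*} {c : V → ι} {B C : Set V} {L : List (V × V)} {p q r v x y : V}
  {T : Set G.Subgraph}

theorem eq_of_reachable (hc : ∀ x y, G.Adj x y → c x = c y) (h : G.Reachable x y) : c x = c y := by
  obtain ⟨w⟩ := h
  induction w with
  | nil => rfl
  | cons h _ ih => exact (hc _ _ h).trans ih

theorem exists_injOn_colour (h : G.PositiveForcing B L C) :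
    ∃ c : V → V, InjOn c B ∧ ∀ e ∈ L, c e.1 = c e.2 := by
  classical
  suffices ∃ c : V → V, (∀ r ∈ B, c r = r) ∧ ∀ e ∈ L, c e.1 = c e.2 by
    obtain ⟨c, hB, hL⟩ := this
    exact ⟨c, fun r hr s hs hrs => by rwa [hB r hr, hB s hs] at hrs, hL⟩
  induction h with
  | nil B => exact ⟨id, fun _ _ => rfl, by simp⟩
  | @cons B _ p q L h _ ih =>
    obtain ⟨c, hB, hL⟩ := ih
    obtain ⟨hp, hq, -⟩ := positiveForces_iff.1 h
    have hpq : p ≠ q := fun hpq => hq (hpq ▸ hp)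
    refine ⟨fun x => if c x = q then p else c x, fun r hr => ?_,
      List.forall_mem_cons.2 ⟨?_, fun e he => by simp only [hL e he]⟩⟩
    · have hrq : r ≠ q := fun hrq => hq (hrq ▸ hr)
      simp [hB r (.inr hr), hrq]
    · simp [hB p (.inr hp), hB q (.inl rfl), hpq]

theorem adj_of_mem (h : G.PositiveForcing B L C) (hpq : (p, q) ∈ L) : G.Adj p q := by
  induction h with
  | nil => cases hpq
  | cons h _ ih =>
    cases hpq with
    | head => exact (positiveForces_iff.1 h).2.2.1
    | tail _ hpq => exact ih hpq

theorem exists_mem_verts_forcingTree (h : G.PositiveForcing B L C) (hv : v ∈ C) :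
    ∃ r ∈ B, v ∈ (G.forcingTree L r).verts := by
  induction h with
  | nil B => exact ⟨v, hv, .refl⟩
  | @cons B C p q L h _ ih =>
    obtain ⟨r, hr, hrv⟩ := ih hv
    have hrv' : v ∈ (G.forcingTree ((p, q) :: L) r).verts :=
      Relation.ReflTransGen.mono (fun _ _ => List.mem_cons_of_mem _) _ _ hrv
    rcases hr with rfl | hr
    · exact ⟨p, h.1, .head List.mem_cons_self hrv'⟩
    · exact ⟨r, hr, hrv'⟩

theorem isAcyclic_fromRel_mem (h : G.PositiveForcing B L C) :
    (fromRel fun x y => (x, y) ∈ L).IsAcyclic := by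
  induction h with
  | nil => exact isAcyclic_bot.anti fun x y h => by simp at h
  | @cons B C p q L h hL ih =>
    obtain ⟨hp, hq, -⟩ := positiveForces_iff.1 h
    obtain ⟨c, hc, hcL⟩ := exists_injOn_colour hL
    have hnr : ¬ (fromRel fun x y => (x, y) ∈ L).Reachable p q := fun hpq => by
      have hcpq : c p = c q := eq_of_reachable (fun x y hxy =>
        ((fromRel_adj _ _ _).1 hxy).2.elim (hcL (x, y)) fun h => (hcL (y, x) h).symm) hpq
      exact hq (hc (.inr hp) (.inl rfl) hcpq ▸ hp)
    refine (ih.sup_edge_of_not_reachable hnr).anti fun x y hxy => ?_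
    simp only [fromRel_adj, List.mem_cons, Prod.mk.injEq, sup_adj, edge_adj] at hxy ⊢
    grind

/-- Different black vertices of the same colour have no neighbours in the same white component. This
is the invariant of a forcing process with differently coloured initial vertices whose forces
preserve the colour. -/
def SeparatesColours (G : SimpleGraph V) (c : V → ι) (B : Set V) : Prop :=
  ∀ x ∈ B, ∀ y ∈ B, c x = c y → ∀ x' ∉ B, ∀ y' ∉ B, G.Adj x x' → G.Adj y y' →
    (whiteGraph G B).Reachable x' y' → x = y

theorem SeparatesColours.insert_of_positiveForces (h : SeparatesColours G c B)
    (hpq : G.PositiveForces B p q) (hc : c p = c q) : SeparatesColours G c (insert q B) := by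
  obtain ⟨hp, hq, hadj, huniq⟩ := positiveForces_iff.1 hpq
  have hwhite : whiteGraph G (insert q B) ≤ whiteGraph G B := fun x y hxy => by
    grind [whiteGraph_adj]
  have hnew : ∀ y ∈ B, c y = c q → ∀ x' ∉ insert q B, ∀ y' ∉ insert q B, G.Adj q x' → G.Adj y y' →
      ¬ (whiteGraph G (insert q B)).Reachable x' y' := by
    intro y hy hyq x' hx' y' hy' hqx hyy hr
    have hqx' : (whiteGraph G B).Adj q x' := whiteGraph_adj.2 ⟨hqx, hq, fun h => hx' (.inr h)⟩
    have hqy' := hqx'.reachable.trans (hr.mono hwhite)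
    have hyB : y' ∉ B := fun h => hy' (.inr h)
    obtain rfl : y = p := h y hy p hp (hyq.trans hc.symm) y' hyB q hq hyy hadj hqy'.symm
    exact hy' (.inl (huniq y' hyy hyB hqy'))
  rintro x (rfl | hx) y (rfl | hy) hxy x' hx' y' hy' hxx hyy hr
  · rfl
  · exact (hnew y hy hxy.symm x' hx' y' hy' hxx hyy hr).elim
  · exact (hnew x hx hxy y' hy' x' hx' hyy hxx hr.symm).elim
  · exact h x hx y hy hxy x' (fun h => hx' (.inr h)) y' (fun h => hy' (.inr h)) hxx hyy
      (hr.mono hwhite)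

theorem SeparatesColours.mem_or_mem_of_adj (hB : SeparatesColours G c B)
    (h : G.PositiveForcing B L C) (hL : ∀ e ∈ L, c e.1 = c e.2) (hx : x ∈ C) (hy : y ∈ C)
    (hxy : G.Adj x y) (hc : c x = c y) (hnot : ¬ (x ∈ B ∧ y ∈ B)) : (x, y) ∈ L ∨ (y, x) ∈ L := by
  induction h with
  | nil B => exact absurd ⟨hx, hy⟩ hnot
  | @cons B C p q L h _ ih =>
    obtain ⟨hcpq, hL⟩ := List.forall_mem_cons.1 hL
    obtain ⟨hp, hq, hpq, -⟩ := positiveForces_iff.1 h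
    have hforced (z : V) (hz : z ∈ B) (hzq : c z = c q) (hadj : G.Adj z q) : z = p :=
      hB z hz p hp (hzq.trans hcpq.symm) q hq q hq hadj hpq .rfl
    by_cases hnot' : x ∈ insert q B ∧ y ∈ insert q B
    · rcases hnot' with ⟨rfl | hxB, rfl | hyB⟩
      · exact absurd rfl hxy.ne
      · exact .inr (hforced y hyB hc.symm hxy.symm ▸ List.mem_cons_self)
      · exact .inl (hforced x hxB hc hxy ▸ List.mem_cons_self)
      · exact absurd ⟨hxB, hyB⟩ hnot
    · exact (ih (hB.insert_of_positiveForces h hcpq) hL hx hy hnot').imp (List.mem_cons_of_mem _)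
        (List.mem_cons_of_mem _)

namespace IsColourForcing

theorem mem_verts_forcingTree_iff (h : IsColourForcing G c B L) (hB : InjOn c B) (hr : r ∈ B) :
    v ∈ (G.forcingTree L r).verts ↔ c v = c r := by
  have hcolour {r v : V} (hv : v ∈ (G.forcingTree L r).verts) : c v = c r := by
    induction hv with
    | refl => rfl
    | tail _ hxy ih => exact (h.colour_eq _ hxy).symm.trans ih
  refine ⟨hcolour, fun hv => ?_⟩
  obtain ⟨s, hs, hsv⟩ := exists_mem_verts_forcingTree h.forcing (mem_univ v)
  exact hB hs hr ((hcolour hsv).symm.trans hv) ▸ hsv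

theorem forcingTree_eq_induce (h : IsColourForcing G c B L) (hB : InjOn c B) (hr : r ∈ B) :
    G.forcingTree L r = (⊤ : G.Subgraph).induce (c ⁻¹' {c r}) := by
  have hverts (v : V) := h.mem_verts_forcingTree_iff hB hr (v := v)
  have hsep : SeparatesColours G c B := fun x hx y hy hxy _ _ _ _ _ _ _ => hB hx hy hxy
  ext x y
  · exact hverts x
  · refine ⟨fun hxy => ⟨(hverts x).1 hxy.1, (hverts y).1 hxy.2.1, hxy.2.2.1⟩, ?_⟩
    rintro ⟨hx, hy, hxy⟩
    have hc : c x = c y := hx.trans hy.symm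
    exact ⟨(hverts x).2 hx, (hverts y).2 hy, hxy, hsep.mem_or_mem_of_adj h.forcing h.colour_eq
      trivial trivial hxy hc fun hxyB => hxy.ne (hB hxyB.1 hxyB.2 hc)⟩

theorem injOn_forcingTree (h : IsColourForcing G c B L) (hB : InjOn c B) :
    InjOn (G.forcingTree L) B := by
  intro r hr s hs hrs
  have hmem : r ∈ (G.forcingTree L r).verts := .refl
  exact hB hr hs ((h.mem_verts_forcingTree_iff hB hs).1 (hrs ▸ hmem))

end IsColourForcing

theorem isTree_forcingTree (h : G.PositiveForcing B L C) (r : V) :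
    (G.forcingTree L r).coe.IsTree := by
  have hroot (x : V) (hx : x ∈ (G.forcingTree L r).verts) :
      (G.forcingTree L r).coe.Reachable ⟨r, .refl⟩ ⟨x, hx⟩ := by
    induction hx with
    | refl => rfl
    | tail hx hxy ih =>
      exact ih.trans (Adj.reachable ⟨hx, hx.tail hxy, adj_of_mem h hxy, .inl hxy⟩)
  have : Nonempty (G.forcingTree L r).verts := ⟨⟨r, .refl⟩⟩
  refine ⟨⟨fun x y => (hroot x x.2).symm.trans (hroot y y.2)⟩, ?_⟩
  let f : (G.forcingTree L r).coe →g fromRel fun x y => (x, y) ∈ L :=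
    ⟨(↑), fun hxy => (fromRel_adj _ _ _).2 ⟨hxy.2.2.1.ne, hxy.2.2.2⟩⟩
  exact (isAcyclic_fromRel_mem h).comap f Subtype.val_injective

theorem isTreeCovering_image_forcingTree (h : G.PositiveForcing B L univ) :
    G.IsTreeCovering (G.forcingTree L '' B) ∧ (G.forcingTree L '' B).ncard = B.ncard := by
  obtain ⟨c, hB, hL⟩ := exists_injOn_colour h
  have hc : IsColourForcing G c B L := ⟨h, hL⟩
  refine ⟨⟨?_, ?_, ?_, ?_⟩, (hc.injOn_forcingTree hB).ncard_image⟩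
  · rintro _ ⟨r, hr, rfl⟩
    exact (Subgraph.isInduced_iff_exists_eq_induce_top _).2 ⟨_, hc.forcingTree_eq_induce hB hr⟩
  · rintro _ ⟨r, -, rfl⟩
    exact isTree_forcingTree h r
  · rintro _ ⟨r, hr, rfl⟩ _ ⟨s, hs, rfl⟩ hne
    refine disjoint_left.2 fun v hvr hvs => hne ?_
    rw [hc.mem_verts_forcingTree_iff hB hr] at hvr
    rw [hc.mem_verts_forcingTree_iff hB hs] at hvs
    rw [hB hr hs (hvr.symm.trans hvs)]
  · refine eq_univ_of_forall fun v => ?_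
    obtain ⟨r, hr, hrv⟩ := exists_mem_verts_forcingTree h (mem_univ v)
    exact mem_biUnion (mem_image_of_mem _ hr) hrv

theorem isAcyclic_monochromatic (h : ∀ v, (G.induce (c ⁻¹' {c v})).IsAcyclic) :
    (monochromatic G c).IsAcyclic := by
  classical
  intro v w hw
  have hcolour : ∀ x ∈ w.support, x ∈ c ⁻¹' {c v} := fun x hx =>
    (eq_of_reachable (G := monochromatic G c) (fun _ _ h => h.2) ⟨w.takeUntil x hx⟩).symm
  have hac : ((monochromatic G c).induce (c ⁻¹' {c v})).IsAcyclic :=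
    (h v).anti (comap_monotone _ fun _ _ hxy => hxy.1)
  refine hac (w.induce _ hcolour) ((Walk.isCycle_map_iff_of_injective
    (f := (Embedding.induce _).toHom) Subtype.val_injective).1 ?_)
  rwa [Walk.map_induce]

theorem isTreeColouring_of_isTree_induce (h : ∀ v, (G.induce (c ⁻¹' {c v})).IsTree) :
    IsTreeColouring G c := by
  refine ⟨isAcyclic_monochromatic fun v => (h v).2, fun x y hxy => ?_⟩
  let f : G.induce (c ⁻¹' {c x}) →g monochromatic G c :=
    ⟨(↑), fun {a b} hab => ⟨hab, a.2.trans b.2.symm⟩⟩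
  exact ((h x).1.preconnected ⟨x, rfl⟩ ⟨y, hxy.symm⟩).map f

theorem exists_colour_of_isTreeCovering (hT : G.IsTreeCovering T) :
    ∃ c : V → G.Subgraph, range c = T ∧ ∀ H ∈ T, (⊤ : G.Subgraph).induce (c ⁻¹' {H}) = H := by
  have hex (v : V) : ∃ H ∈ T, v ∈ H.verts := by
    simpa only [mem_iUnion, exists_prop] using hT.cover.superset (mem_univ v)
  choose c hcT hvc using hex
  have hc (v : V) (H : G.Subgraph) (hH : H ∈ T) (hv : v ∈ H.verts) : c v = H := by
    by_contra hne
    exact disjoint_left.1 (hT.disjoint (hcT v) hH hne) (hvc v) hv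
  refine ⟨c, subset_antisymm (range_subset_iff.2 hcT) fun H hH => ?_, fun H hH => ?_⟩
  · obtain ⟨⟨v, hv⟩⟩ := (hT.isTree H hH).1.nonempty
    exact ⟨v, hc v H hH hv⟩
  · have hverts : c ⁻¹' {H} = H.verts := by
      ext v
      exact ⟨fun hv => (show c v = H from hv) ▸ hvc v, hc v H hH⟩
    rw [hverts, (hT.isInduced H hH).induce_top_verts]

theorem exists_eq_image_forcingTree [Finite V] (hG : ¬ IsMinor (completeGraph (Fin 4)) G)
    (hT : G.IsTreeCovering T) :
    ∃ B L, G.PositiveForcing B L univ ∧ T = G.forcingTree L '' B := by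
  obtain ⟨c, rfl, hc⟩ := exists_colour_of_isTreeCovering hT
  have hc' (v : V) := hc (c v) (mem_range_self v)
  have htree : IsTreeColouring G c := isTreeColouring_of_isTree_induce fun v => by
    have hv : ((⊤ : G.Subgraph).induce (c ⁻¹' {c v})).coe.IsTree := by
      rw [hc' v]
      exact hT.isTree _ (mem_range_self v)
    rwa [induce_eq_coe_induce_top]
  obtain ⟨B, L, hL, hB⟩ := htree.exists_isColourForcing hG
  refine ⟨B, L, hL.forcing, ?_⟩
  rw [← hB.image_eq]
  exact image_congr fun r hr => by rw [hL.forcingTree_eq_induce hB.injOn hr, hc' r]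

theorem treeCoverNumber_le_positiveZeroForcingNumber (G : SimpleGraph V) :
    G.treeCoverNumber ≤ G.positiveZeroForcingNumber := by
  have hne : {k | ∃ B : Set V, G.IsPositiveZeroForcingSet B ∧ B.ncard = k}.Nonempty :=
    ⟨_, univ, ⟨[], .nil _⟩, rfl⟩
  obtain ⟨B, ⟨L, hL⟩, hB⟩ := Nat.sInf_mem hne
  obtain ⟨hT, hTB⟩ := isTreeCovering_image_forcingTree hL
  exact Nat.sInf_le ⟨_, hT, hTB.trans hB⟩

theorem exists_isTreeCovering_ncard_eq (G : SimpleGraph V) :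
    ∃ T, G.IsTreeCovering T ∧ T.ncard = G.treeCoverNumber :=
  Nat.sInf_mem (s := {k | ∃ T : Set G.Subgraph, G.IsTreeCovering T ∧ T.ncard = k})
    ⟨_, _, (isTreeCovering_image_forcingTree (.nil univ)).1, rfl⟩

end ForcingTree

end PositiveZeroForcing

open PositiveZeroForcing in
theorem theorem8p3_general {V : Type*} [Finite V] (G : SimpleGraph V)
    (hG : ¬ IsMinor (completeGraph (Fin 4)) G) :
    G.positiveZeroForcingNumber = G.treeCoverNumber ∧
    ∀ T : Set G.Subgraph, G.IsTreeCovering T → T.ncard = G.treeCoverNumber →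
      ∃ (B : Set V) (L : List (V × V)),
        G.PositiveForcing B L Set.univ ∧ B.ncard = G.positiveZeroForcingNumber ∧
        T.ncard = G.positiveZeroForcingNumber ∧
        T = {H | ∃ r ∈ B, H = G.forcingTree L r} := by
  have hforcing (T : Set G.Subgraph) (hT : G.IsTreeCovering T) : ∃ B L,
      G.PositiveForcing B L univ ∧ B.ncard = T.ncard ∧ T = G.forcingTree L '' B := by
    obtain ⟨B, L, hL, rfl⟩ := exists_eq_image_forcingTree hG hT
    exact ⟨B, L, hL, (isTreeCovering_image_forcingTree hL).2.symm, rfl⟩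
  have heq : G.positiveZeroForcingNumber = G.treeCoverNumber := by
    refine le_antisymm ?_ (treeCoverNumber_le_positiveZeroForcingNumber G)
    obtain ⟨T, hT, hTk⟩ := exists_isTreeCovering_ncard_eq G
    obtain ⟨B, L, hL, hB, -⟩ := hforcing T hT
    exact Nat.sInf_le ⟨B, ⟨L, hL⟩, hB.trans hTk⟩
  refine ⟨heq, fun T hT hTk => ?_⟩
  obtain ⟨B, L, hL, hB, hTB⟩ := hforcing T hT
  refine ⟨B, L, hL, by rw [hB, hTk, heq], by rw [hTk, heq], ?_⟩
  simpa only [image, eq_comm] using hTB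

theorem theorem8p3 {V : Type*} [Finite V] (G : SimpleGraph V) (hG : G.IsOuterplanar) :
    G.positiveZeroForcingNumber = G.treeCoverNumber ∧
    ∀ T : Set G.Subgraph, G.IsTreeCovering T → T.ncard = G.treeCoverNumber →
      ∃ (B : Set V) (L : List (V × V)),
        G.PositiveForcing B L Set.univ ∧ B.ncard = G.positiveZeroForcingNumber ∧
        T.ncard = G.positiveZeroForcingNumber ∧
        T = {H | ∃ r ∈ B, H = G.forcingTree L r} :=
  theorem8p3_general G (PositiveZeroForcing.not_isMinor_of_isOuterplanar hG)
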